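/- **Setting.** Let $\mathcal M=(\mathcal S,\mathcal A,P,r,\gamma,\rho)$ be a discounted Markov decision process with $\gamma\in(0,1)$, transition kernel $P(\cdot\mid s,a)$, reward $r(s,a)$ and initial distribution $\rho$, and let $\pi_\theta(a\mid s)$, $\theta\in\mathbb R^d$, be a parameterised policy (a probability mass function, or more generally a probability density with respect to a fixed $\sigma$-finite measure, on the actions). For a horizon $H$, let $p(\cdot\mid\pi_\theta)$ be the law of the trajectory $\tau=(s_0,a_0,\dots,s_{H-1},a_{H-1})$ with $s_0\sim\rho$, $a_h\sim\pi_\theta(\cdot\mid s_h)$, $s_{h+1}\sim P(\cdot\mid s_h,a_h)$. Put $$J(\theta)=\mathbb E_{\tau\sim p(\cdot\mid\pi_\theta)}\Big[\sum_{h=0}^{H-1}\gamma^h r(s_h,a_h)\Big],\qquad \Psi_h(\tau)=\sum_{t=h}^{H-1}\gamma^t r(s_t,a_t),\qquad \Phi(\theta;\tau)=\sum_{h=0}^{H-1}\Psi_h(\tau)\log\pi_\theta(a_h\mid s_h),$$ $$g(\tau;\theta)=\sum_{h=0}^{H-1}\Psi_h(\tau)\nabla_\theta\log\pi_\theta(a_h\mid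 s_h),\qquad B(\tau;\theta)=\nabla\Phi(\theta;\tau)\,\nabla\log p(\tau\mid\pi_\theta)^{\top}+\nabla^2\Phi(\theta;\tau).$$ **Assumptions.** (1) There is $R_0>0$ with $|r(s,a)|<R_0$ for all $s,a$. (2) For all $s,a$, $\log\pi_\theta(a\mid s)$ is defined and twice differentiable in $\theta$, and there are $G,L>0$ with $\|\nabla\log\pi_\theta(a\mid s)\|\le G$ and $\|\nabla^2\log\pi_\theta(a\mid s)\|\le L$ (operator norm) for all $\theta,s,a$. **Algorithm (SHARP).** Given $\theta_0\in\mathbb R^d$, $\alpha_0,\eta_0$ and $T\ge1$: sample $\tau_0\sim p(\cdot\mid\pi_{\theta_0})$, put $v_0=g(\tau_0;\theta_0)$ and $\theta_1=\theta_0+\eta_0v_0/\|v_0\|$. For $t=1,\dots,T-1$, sample $b_t$ uniformly on $[0,1]$ independently of the past, put $\theta_t^b=b_t\theta_t+(1-b_t)\theta_{t-1}$, sample $\tau_t\sim p(\cdot\mid\pi_{\theta_t})$ and $\tau_t^b\sim p(\cdot\mid\pi_{\theta_t^b})$ (independently, given the past and $b_t$), and put, with $\eta_t=\eta_0/t^{2/3}$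 and $\alpha_t=\alpha_0/t^{2/3}$, $$v_t=(1-\alpha_t)\big(v_{t-1}+B(\tau_t^b;\theta_t^b)(\theta_t-\theta_{t-1})\big)+\alpha_t\,g(\tau_t;\theta_t),\qquad \theta_{t+1}=\theta_t+\eta_t\frac{v_t}{\|v_t\|},$$ where $v/\|v\|$ is read as $0$ if $v=0$. **Theorem.** Under assumptions (1) and (2), for all $\alpha_0\in(2/3,1]$, $\eta_0>0$, $\theta_0\in\mathbb R^d$ and $T\ge1$, the function $J$ is differentiable, and the iterates of SHARP satisfy $$\mathbb E\Big[\frac1T\sum_{t=1}^T\|\nabla J(\theta_t)\|\Big]\le\frac{8\sqrt C+9C_J/\eta_0}{T^{1/3}}+\frac{6\sigma_B\eta_0}{T^{2/3}},$$ the random variable on the left being integrable, where $$C=\frac{3\alpha_0\big(48\sigma_B^2\eta_0^2/\alpha_0+(6\alpha_0+1/\alpha_0)\sigma_g^2\big)}{3\alpha_0-2},\quad C_J=\frac{R_0}{1-\gamma},\quad \sigma_g^2=\frac{G^2R_0^2}{(1-\gamma)^4},\quad \sigma_B^2=\frac{H^2G^4R_0^2+L^2R_0^2}{(1-\gamma)^4}$$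 with $\sigma_g,\sigma_B\ge0$. -/

import Mathlib

open MeasureTheory ProbabilityTheory
open scoped ENNReal

/-- A discounted MDP `(S, A, P, r, γ, ρ)`; the state and action spaces are arbitrary measurable
spaces (discrete or continuous). -/
structure MDP (S A : Type*) [MeasurableSpace S] [MeasurableSpace A] where
  /-- transition kernel `P(· | s, a)` -/
  P : Kernel (S × A) S
  markov_P : IsMarkovKernel P
  /-- reward `r(s, a)` -/
  r : S → A → ℝ
  measurable_r : Measurable fun x : S × A => r x.1 x.2
  /-- discount factor -/
  γ : ℝ
  γ_pos : 0 < γ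
  γ_lt_one : γ < 1
  /-- distribution of the starting state -/
  ρ : Measure S
  prob_ρ : IsProbabilityMeasure ρ

/-- A policy parameterised by `θ ∈ ℝᵈ`: for each `θ` and `s`, `dens θ s` is a probability density
on the actions with respect to the reference measure `ν` (the counting measure for discrete
actions, so that `dens θ s a` is then the probability of `a`). -/
structure ParamPolicy (S A : Type*) [MeasurableSpace S] [MeasurableSpace A]
    (d : ℕ) (ν : Measure A) where
  dens : EuclideanSpace ℝ (Fin d) → S → A → ℝ
  nonneg : ∀ θ s a, 0 ≤ dens θ s a
  measurable_dens :
    Measurable fun x : EuclideanSpace ℝ (Fin d) × S × A => dens x.1 x.2.1 x.2.2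
  lintegral_dens : ∀ θ s, ∫⁻ a, ENNReal.ofReal (dens θ s a) ∂ν = 1

/-- A trajectory `(s₀, a₀, …, s_{H-1}, a_{H-1})`. -/
abbrev Traj (S A : Type*) (H : ℕ) := Fin H → S × A

noncomputable section

namespace MDP

variable {S A : Type*} [MeasurableSpace S] [MeasurableSpace A] (M : MDP S A)

instance : IsMarkovKernel M.P := M.markov_P

instance : IsProbabilityMeasure M.ρ := M.prob_ρ

/-- Law of the state `s_n` given `(s₀, a₀, …, s_{n-1}, a_{n-1})`. -/
def stateKernel : (n : ℕ) → Kernel (Traj S A n) S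
  | 0 => Kernel.const _ M.ρ
  | n + 1 => M.P.comap (fun τ => τ (Fin.last n)) (measurable_pi_apply _)

/-- The measure `ρ(ds₀) ν(da₀) ∏_{h ≥ 1} P(ds_h | s_{h-1}, a_{h-1}) ν(da_h)` on trajectories,
with respect to which trajectory laws have densities. -/
def trajBase (ν : Measure A) : (n : ℕ) → Measure (Traj S A n)
  | 0 => Measure.dirac Fin.elim0
  | n + 1 => (trajBase ν n ⊗ₘ (M.stateKernel n ×ₖ Kernel.const _ ν)).map
      (fun x => (Fin.snoc x.1 x.2 : Traj S A (n + 1)))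

/-- Discounted cumulative reward `R(τ)` of a trajectory. -/
def ret {H : ℕ} (τ : Traj S A H) : ℝ :=
  ∑ h : Fin H, M.γ ^ (h : ℕ) * M.r (τ h).1 (τ h).2

/-- `Ψ_h(τ) = ∑_{t = h}^{H-1} γ^t r(s_t, a_t)`. -/
def rewardToGo {H : ℕ} (h : Fin H) (τ : Traj S A H) : ℝ :=
  ∑ t ∈ Finset.Ici h, M.γ ^ (t : ℕ) * M.r (τ t).1 (τ t).2

variable {d H : ℕ} {ν : Measure A} (pol : ParamPolicy S A d ν)

/-- `∏_h π_θ(a_h | s_h)`: the density of the trajectory with respect to `trajBase`. -/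
def trajDens (θ : EuclideanSpace ℝ (Fin d)) (τ : Traj S A H) : ℝ :=
  ∏ h : Fin H, pol.dens θ (τ h).1 (τ h).2

/-- The law `p(· | π_θ)` of a trajectory of length `H` under the policy `π_θ`. -/
def trajLaw (H : ℕ) (θ : EuclideanSpace ℝ (Fin d)) : Measure (Traj S A H) :=
  (M.trajBase ν H).withDensity fun τ => ENNReal.ofReal (trajDens pol θ τ)

/-- Expected return `J(θ)`. -/
def J (H : ℕ) (θ : EuclideanSpace ℝ (Fin d)) : ℝ :=
  ∫ τ, M.ret τ ∂(M.trajLaw pol H θ)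

/-- `Φ(θ; τ) = ∑_h Ψ_h(τ) log π_θ(a_h | s_h)`. -/
def Phi (τ : Traj S A H) (θ : EuclideanSpace ℝ (Fin d)) : ℝ :=
  ∑ h : Fin H, M.rewardToGo h τ * Real.log (pol.dens θ (τ h).1 (τ h).2)

/-- Gradient estimator `g(τ; θ) = ∑_h Ψ_h(τ) ∇ log π_θ(a_h | s_h)`. -/
def gradEst (τ : Traj S A H) (θ : EuclideanSpace ℝ (Fin d)) : EuclideanSpace ℝ (Fin d) :=
  ∑ h : Fin H, M.rewardToGo h τ •
    gradient (fun θ' => Real.log (pol.dens θ' (τ h).1 (τ h).2)) θ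

/-- Hessian estimator `B(τ; θ) = ∇Φ(θ; τ) (∇ log p(τ | π_θ))ᵀ + ∇²Φ(θ; τ)` as a linear map.
The initial and transition laws do not depend on `θ`, so `∇ log p` is the gradient of the logarithm
of the density `trajDens`. -/
def hessEst (τ : Traj S A H) (θ : EuclideanSpace ℝ (Fin d)) :
    EuclideanSpace ℝ (Fin d) →L[ℝ] EuclideanSpace ℝ (Fin d) :=
  (innerSL ℝ (gradient (fun θ' => Real.log (trajDens pol θ' τ)) θ)).smulRight
      (gradient (M.Phi pol τ) θ)
    + fderiv ℝ (gradient (M.Phi pol τ)) θ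

/-- Bounded reward with constant `R₀`. -/
def BoundedReward (R₀ : ℝ) : Prop := ∀ s a, |M.r s a| < R₀

/-- `σ_g`, with `σ_g² = G² R₀² / (1-γ)⁴`. -/
def sigmaG (R₀ G : ℝ) : ℝ := Real.sqrt (G ^ 2 * R₀ ^ 2 / (1 - M.γ) ^ 4)

/-- `σ_B`, with `σ_B² = (H² G⁴ R₀² + L² R₀²) / (1-γ)⁴`. -/
def sigmaB (H : ℕ) (R₀ G L : ℝ) : ℝ :=
  Real.sqrt (((H : ℝ) ^ 2 * G ^ 4 * R₀ ^ 2 + L ^ 2 * R₀ ^ 2) / (1 - M.γ) ^ 4)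

end MDP

/-- Regularity of the parameterisation: `log π_θ(a | s)` is defined and twice differentiable in `θ`,
with gradient bounded by `G` and Hessian bounded (in operator norm) by `L`. -/
structure ParamPolicy.Regular {S A : Type*} [MeasurableSpace S] [MeasurableSpace A]
    {d : ℕ} {ν : Measure A} (pol : ParamPolicy S A d ν) (G L : ℝ) : Prop where
  pos : ∀ θ s a, 0 < pol.dens θ s a
  differentiable : ∀ s a, Differentiable ℝ fun θ => Real.log (pol.dens θ s a)
  differentiable_gradient : ∀ s a,
    Differentiable ℝ (gradient fun θ => Real.log (pol.dens θ s a))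
  gradient_le : ∀ θ s a, ‖gradient (fun θ' => Real.log (pol.dens θ' s a)) θ‖ ≤ G
  hessian_le : ∀ θ s a,
    ‖fderiv ℝ (gradient fun θ' => Real.log (pol.dens θ' s a)) θ‖ ≤ L

/-- Learning rates `η_0 = η₀` and `η_t = η₀ / t^{2/3}` for `t ≥ 1`. -/
def sharpEta (η₀ : ℝ) (t : ℕ) : ℝ :=
  if t = 0 then η₀ else η₀ / (t : ℝ) ^ ((2 : ℝ) / 3)

/-- Momentum weights `α_t = α₀ / t^{2/3}` (used for `t ≥ 1` only). -/
def sharpAlpha (α₀ : ℝ) (t : ℕ) : ℝ := α₀ / (t : ℝ) ^ ((2 : ℝ) / 3)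

/-- The random variables `θ_t, v_t, b_t, τ_t, τ_t^b` on `(Ω, μ)` are a run of SHARP with `T`
iterations, horizon `H`, initial point `θ₀` and parameters `α₀, η₀`. `ℱ t` is the information
available after iteration `t`, for instance the history `σ(τ_0, b_1, τ_1, τ_1^b, …, b_t, τ_t, τ_t^b)`.
The vector `v / ‖v‖` is read as `0` for `v = 0`. -/
structure IsSharpRun {S A Ω : Type*} [MeasurableSpace S] [MeasurableSpace A]
    [mΩ : MeasurableSpace Ω] {d : ℕ} {ν : Measure A} (M : MDP S A) (pol : ParamPolicy S A d ν)
    (H T : ℕ) (θ₀ : EuclideanSpace ℝ (Fin d)) (α₀ η₀ : ℝ) (μ : Measure Ω) (ℱ : Filtration ℕ mΩ)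
    (θ v : ℕ → Ω → EuclideanSpace ℝ (Fin d)) (b : ℕ → Ω → ℝ) (τ τb : ℕ → Ω → Traj S A H) :
    Prop where
  measurable_traj : ∀ t, t < T → Measurable[ℱ t] (τ t)
  measurable_unif : ∀ t, 1 ≤ t → t < T → Measurable[ℱ t] (b t)
  measurable_trajb : ∀ t, 1 ≤ t → t < T → Measurable[ℱ t] (τb t)
  /-- initial point -/
  theta_zero : ∀ ω, θ 0 ω = θ₀
  /-- `τ_0` is sampled with the policy `π_{θ_0}` -/
  law_traj_zero : μ.map (τ 0) = M.trajLaw pol H θ₀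
  v_zero : ∀ ω, v 0 ω = M.gradEst pol (τ 0 ω) (θ 0 ω)
  /-- Conditionally on the past `ℱ (t-1)`: `b_t` is uniform on `[0,1]`, and given `b_t` also, `τ_t`
  and `τ_t^b` are independent with laws `p(· | π_{θ_t})` and `p(· | π_{θ_t^b})`, where
  `θ_t^b = b_t θ_t + (1 - b_t) θ_{t-1}`. -/
  sampling : ∀ t, 1 ≤ t → t < T → ∀ D : Set Ω, MeasurableSet[ℱ (t - 1)] D →
    ∀ f : ℝ × Traj S A H × Traj S A H → ℝ≥0∞, Measurable f →
      ∫⁻ ω in D, f (b t ω, τ t ω, τb t ω) ∂μ =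
        ∫⁻ ω in D, ∫⁻ u in Set.Icc (0 : ℝ) 1,
          ∫⁻ y, ∫⁻ y', f (u, y, y')
            ∂(M.trajLaw pol H (u • θ t ω + (1 - u) • θ (t - 1) ω))
            ∂(M.trajLaw pol H (θ t ω)) ∂volume ∂μ
  v_step : ∀ t, 1 ≤ t → t < T → ∀ ω,
    v t ω = (1 - sharpAlpha α₀ t) • (v (t - 1) ω +
        M.hessEst pol (τb t ω) (b t ω • θ t ω + (1 - b t ω) • θ (t - 1) ω)
          (θ t ω - θ (t - 1) ω))
      + sharpAlpha α₀ t • M.gradEst pol (τ t ω) (θ t ω)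
  theta_step : ∀ t, t < T → ∀ ω,
    θ (t + 1) ω = θ t ω + sharpEta η₀ t • (‖v t ω‖⁻¹ • v t ω)

/-- `C = 3α₀ (48 σ_B² η₀² / α₀ + (6α₀ + 1/α₀) σ_g²) / (3α₀ - 2)`. -/
def sharpC (α₀ η₀ σg σB : ℝ) : ℝ :=
  3 * α₀ * (48 * σB ^ 2 * η₀ ^ 2 / α₀ + (6 * α₀ + 1 / α₀) * σg ^ 2) / (3 * α₀ - 2)

end

noncomputable section

/-! ### Trajectory laws -/

namespace MDP

variable {S A : Type*} [MeasurableSpace S] [MeasurableSpace A] (M : MDP S A)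

/-! The trajectory law has density `∏ π_θ(a_h | s_h)` and its score is bounded by `H G`, so
expectations over trajectories may be differentiated under the integral
(`MDP.hasFDerivAt_integral_trajLaw`). Hence `g` is unbiased for `∇J` (`MDP.hasGradientAt_J`) and `B`
is unbiased for `∇²J` (`MDP.hasFDerivAt_gradient_J`). Averaging `B` over a uniform point of the
segment from `θ_{t-1}` to `θ_t` gives exactly `∇J(θ_t) - ∇J(θ_{t-1})`
(`MDP.integral_hessEst_segment`). Both estimators are bounded everywhere: `‖g‖ ≤ σ_g` and `‖B‖ ≤ K =
(H G² + L) R₀ / (1-γ)²`, with `K² ≤ 2 σ_B²`.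

Put `e_t = v_t - ∇J(θ_t)`. Then `e_t = (1-α_t) e_{t-1} - m_t + Z_t`, where `Z_t` is the sampled
increment and `m_t` its conditional mean given the past. The cross term with `Z_t - m_t` vanishes in
expectation, so `E‖e_t‖² ≤ (1-α_t)² E‖e_{t-1}‖² + sup ‖Z_t‖²`
(`IsSharpRun.integral_norm_sq_error_le`). Normalised steps have length at most `η_{t-1}`, so `Z_t`
is `O(t^{-2/3})` surely, and the recursion yields `E‖e_t‖² ≤ C t^{-2/3}`
(`le_sharpC_div_of_recursion`).

Since `∇J` is `K`-Lipschitz, a step along `v/‖v‖` increases `J` by at least `η_t (‖∇J‖ - 2‖e_t‖) - K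
η_t²` (`IsSharpRun.norm_gradient_J_theta_le`). Dividing by `η_t` and summing, the increments of `J`
are handled by Abel summation and cost `O(T^{2/3})`, the errors `∑ t^{-1/3}` also cost `O(T^{2/3})`,
and the curvature terms `∑ t^{-2/3}` cost `O(T^{1/3})`. Division by `T` gives the rate. -/

instance isMarkovKernel_stateKernel (n : ℕ) : IsMarkovKernel (M.stateKernel n) := by
  cases n with
  | zero => unfold stateKernel; infer_instance
  | succ n => unfold stateKernel; infer_instance

variable {d H : ℕ} {ν : Measure A} (pol : ParamPolicy S A d ν)

instance sFinite_trajBase [SFinite ν] (n : ℕ) : SFinite (M.trajBase ν n) := by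
  cases n with
  | zero => unfold trajBase; infer_instance
  | succ n => unfold trajBase; infer_instance

lemma measurable_snoc (n : ℕ) : Measurable
    (fun x : Traj S A n × (S × A) => (Fin.snoc x.1 x.2 : Traj S A (n + 1))) := by
  refine measurable_pi_lambda _ fun i => ?_
  refine Fin.lastCases ?_ (fun j => ?_) i
  · simpa using measurable_snd
  · simpa [Function.comp_def] using (measurable_pi_apply j).comp measurable_fst

lemma measurable_init (n : ℕ) :
    Measurable (fun τ : Traj S A (n + 1) => (Fin.init τ : Traj S A n)) :=
  measurable_pi_lambda _ fun i => measurable_pi_apply i.castSucc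

lemma measurable_trajDens_uncurry :
    Measurable fun x : EuclideanSpace ℝ (Fin d) × Traj S A H => trajDens pol x.1 x.2 := by
  unfold trajDens
  refine Finset.measurable_fun_prod _ fun h _ => ?_
  exact pol.measurable_dens.comp (measurable_fst.prodMk
    ((measurable_fst.comp ((measurable_pi_apply h).comp measurable_snd)).prodMk
      (measurable_snd.comp ((measurable_pi_apply h).comp measurable_snd))))

lemma measurable_trajDens (θ : EuclideanSpace ℝ (Fin d)) :
    Measurable fun τ : Traj S A H => trajDens pol θ τ :=
  (measurable_trajDens_uncurry pol).comp (measurable_const.prodMk measurable_id)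

lemma trajDens_nonneg (θ : EuclideanSpace ℝ (Fin d)) (τ : Traj S A H) : 0 ≤ trajDens pol θ τ :=
  Finset.prod_nonneg fun _ _ => pol.nonneg _ _ _

lemma trajDens_snoc (θ : EuclideanSpace ℝ (Fin d)) (τ : Traj S A H) (x : S × A) :
    trajDens pol θ (Fin.snoc τ x : Traj S A (H + 1)) = trajDens pol θ τ * pol.dens θ x.1 x.2 := by
  simp [trajDens, Fin.prod_univ_castSucc]

/-- The state kernel is Markov and each action density integrates to one, so integrating out the
last pair leaves a factor one. This consistency in the horizon gives total mass one and drives the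
induction in the policy gradient theorem. -/
lemma lintegral_trajLaw_succ_init [SFinite ν] (n : ℕ) (θ : EuclideanSpace ℝ (Fin d))
    {f : Traj S A n → ℝ≥0∞} (hf : Measurable f) :
    ∫⁻ τ, f (Fin.init τ) ∂(M.trajLaw pol (n + 1) θ) = ∫⁻ τ, f τ ∂(M.trajLaw pol n θ) := by
  have hm := (measurable_trajDens (H := n) pol θ).ennreal_ofReal
  have hm' := (measurable_trajDens (H := n + 1) pol θ).ennreal_ofReal
  have hfi : Measurable fun τ : Traj S A (n + 1) => f (Fin.init τ) := hf.comp (measurable_init n)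
  have hd : Measurable fun x : S × A => ENNReal.ofReal (pol.dens θ x.1 x.2) :=
    (pol.measurable_dens.comp (measurable_const.prodMk measurable_id)).ennreal_ofReal
  have h1 : ∀ τ : Traj S A n, ∫⁻ x, ENNReal.ofReal (pol.dens θ x.1 x.2)
      ∂((M.stateKernel n ×ₖ Kernel.const _ ν) τ) = 1 := by
    intro τ
    rw [Kernel.prod_apply, lintegral_prod _ hd.aemeasurable]
    simp [pol.lintegral_dens]
  unfold trajLaw
  rw [lintegral_withDensity_eq_lintegral_mul _ hm' hfi,
    lintegral_withDensity_eq_lintegral_mul _ hm hf]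
  conv_lhs => rw [trajBase]
  rw [lintegral_map (hm'.mul hfi) (measurable_snoc n)]
  refine (Measure.lintegral_compProd ((hm'.mul hfi).comp (measurable_snoc n))).trans ?_
  refine lintegral_congr fun τ => ?_
  simp only [Pi.mul_apply, Function.comp_apply, Fin.init_snoc, trajDens_snoc,
    ENNReal.ofReal_mul (trajDens_nonneg pol θ τ)]
  have : ∀ x : S × A, ENNReal.ofReal (trajDens pol θ τ) * ENNReal.ofReal (pol.dens θ x.1 x.2) * f τ
      = (ENNReal.ofReal (trajDens pol θ τ) * f τ) * ENNReal.ofReal (pol.dens θ x.1 x.2) :=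
    fun x => by ring
  simp only [this]
  rw [lintegral_const_mul _ hd, h1, mul_one]

lemma map_init_trajLaw [SFinite ν] (n : ℕ) (θ : EuclideanSpace ℝ (Fin d)) :
    (M.trajLaw pol (n + 1) θ).map (fun τ => (Fin.init τ : Traj S A n)) = M.trajLaw pol n θ := by
  refine Measure.ext_of_lintegral _ fun f hf => ?_
  rw [lintegral_map hf (measurable_init n), lintegral_trajLaw_succ_init M pol n θ hf]

lemma integral_trajLaw_succ_init [SFinite ν] {V : Type*} [NormedAddCommGroup V] [NormedSpace ℝ V]
    (n : ℕ) (θ : EuclideanSpace ℝ (Fin d)) {f : Traj S A n → V}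
    (hf : AEStronglyMeasurable f (M.trajLaw pol n θ)) :
    ∫ τ, f (Fin.init τ) ∂(M.trajLaw pol (n + 1) θ) = ∫ τ, f τ ∂(M.trajLaw pol n θ) := by
  rw [← map_init_trajLaw M pol n θ] at hf ⊢
  rw [integral_map (measurable_init n).aemeasurable hf]

instance isProbabilityMeasure_trajLaw [SFinite ν] (n : ℕ) (θ : EuclideanSpace ℝ (Fin d)) :
    IsProbabilityMeasure (M.trajLaw pol n θ) := by
  constructor
  induction n with
  | zero => simp [trajLaw, trajBase, trajDens]
  | succ n ih =>
    have := lintegral_trajLaw_succ_init M pol n θ (f := fun _ => 1) measurable_const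
    simpa [ih] using this

/-- The trajectory laws, as a kernel from parameters to trajectories. -/
def trajKernel [SFinite ν] (H : ℕ) : Kernel (EuclideanSpace ℝ (Fin d)) (Traj S A H) where
  toFun := M.trajLaw pol H
  measurable' := by
    refine Measure.measurable_of_measurable_coe _ fun s hs => ?_
    have hm := (measurable_trajDens_uncurry (H := H) pol).ennreal_ofReal
    simp only [trajLaw, withDensity_apply _ hs]
    exact Measurable.lintegral_prod_right' (ν := (M.trajBase ν H).restrict s) hm

@[simp] lemma trajKernel_apply [SFinite ν] (θ : EuclideanSpace ℝ (Fin d)) :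
    M.trajKernel pol H θ = M.trajLaw pol H θ := rfl

instance isMarkovKernel_trajKernel [SFinite ν] : IsMarkovKernel (M.trajKernel pol H) :=
  ⟨fun θ => by rw [trajKernel_apply]; infer_instance⟩

end MDP

end

noncomputable section

/-! ### Measurability of derivatives -/

/-- The derivative is a pointwise limit of difference quotients with step `1/(n+1)`, each jointly
measurable. Joint measurability matters because the base point and the direction will be random
iterates. -/
lemma measurable_fderiv_apply_of_hasFDerivAt {X E F : Type*} [MeasurableSpace X]
    [NormedAddCommGroup E] [NormedSpace ℝ E] [MeasurableSpace E] [BorelSpace E]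
    [SecondCountableTopology E] [NormedAddCommGroup F] [NormedSpace ℝ F] [MeasurableSpace F]
    [BorelSpace F] [SecondCountableTopology F] {f : X → E → F} {f' : X → E → E →L[ℝ] F}
    (hf : Measurable fun p : X × E => f p.1 p.2) (hf' : ∀ x e, HasFDerivAt (f x) (f' x e) e) :
    Measurable fun p : X × E × E => f' p.1 p.2.1 p.2.2 := by
  have hlim : ∀ p : X × E × E, Filter.Tendsto (fun n : ℕ => ((n : ℝ) + 1) •
      (f p.1 (p.2.1 + ((n : ℝ) + 1)⁻¹ • p.2.2) - f p.1 p.2.1)) Filter.atTop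
      (nhds (f' p.1 p.2.1 p.2.2)) := fun p => by
    refine (hf' p.1 p.2.1).lim p.2.2 ?_
    refine Filter.tendsto_abs_atTop_atTop.comp ?_
    exact Filter.tendsto_atTop_add_const_right _ _ tendsto_natCast_atTop_atTop
  refine measurable_of_tendsto_metrizable (fun n => ?_) (tendsto_pi_nhds.2 hlim)
  have h1 : Measurable fun p : X × E × E => (p.1, p.2.1 + ((n : ℝ) + 1)⁻¹ • p.2.2) :=
    measurable_fst.prodMk (measurable_snd.fst.add (measurable_snd.snd.const_smul _))
  have h2 : Measurable fun p : X × E × E => (p.1, p.2.1) :=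
    measurable_fst.prodMk measurable_snd.fst
  exact ((hf.comp h1).sub (hf.comp h2)).const_smul _

lemma measurable_of_measurable_inner {X : Type*} [MeasurableSpace X] {d : ℕ}
    {f : X → EuclideanSpace ℝ (Fin d)} (hf : ∀ w, Measurable fun x => inner ℝ w (f x)) :
    Measurable f := by
  have : f = fun x => ∑ i, inner ℝ (EuclideanSpace.basisFun (Fin d) ℝ i) (f x) •
      EuclideanSpace.basisFun (Fin d) ℝ i := by
    funext x
    exact ((EuclideanSpace.basisFun (Fin d) ℝ).sum_repr' (f x)).symm
  rw [this]
  exact Finset.measurable_fun_sum _ fun i _ => (hf _).smul_const _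

/-- The domain is finite-dimensional, so an operator is a finite combination of its values on a
basis. Needed because the Hessian estimator is integrated as an operator. -/
lemma stronglyMeasurable_clm_of_measurable_apply {X F : Type*} [MeasurableSpace X] {d : ℕ}
    [NormedAddCommGroup F] [NormedSpace ℝ F] [MeasurableSpace F] [BorelSpace F]
    [SecondCountableTopology F] {f : X → EuclideanSpace ℝ (Fin d) →L[ℝ] F}
    (hf : ∀ w, Measurable fun x => f x w) : StronglyMeasurable f := by
  have : f = fun x => ∑ i, ContinuousLinearMap.smulRightL ℝ (EuclideanSpace ℝ (Fin d)) F
      (innerSL ℝ (EuclideanSpace.basisFun (Fin d) ℝ i))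
      (f x (EuclideanSpace.basisFun (Fin d) ℝ i)) := by
    funext x
    ext w
    conv_lhs => rw [← (EuclideanSpace.basisFun (Fin d) ℝ).sum_repr' w]
    simp
  rw [this]
  refine Finset.stronglyMeasurable_fun_sum _ fun i _ => ?_
  exact (ContinuousLinearMap.continuous _).comp_stronglyMeasurable (hf _).stronglyMeasurable

lemma toDual_eq_innerSL {E : Type*} [NormedAddCommGroup E] [InnerProductSpace ℝ E]
    [CompleteSpace E] (x : E) : (InnerProductSpace.toDual ℝ E x : E →L[ℝ] ℝ) = innerSL ℝ x := by
  ext; simp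

namespace ParamPolicy.Regular

variable {S A : Type*} [MeasurableSpace S] [MeasurableSpace A] {d : ℕ} {ν : Measure A}
  {pol : ParamPolicy S A d ν} {G L : ℝ}

lemma measurable_gradient (hpol : pol.Regular G L) :
    Measurable fun x : (S × A) × EuclideanSpace ℝ (Fin d) =>
      gradient (fun θ => Real.log (pol.dens θ x.1.1 x.1.2)) x.2 := by
  have hlog : Measurable fun x : (S × A) × EuclideanSpace ℝ (Fin d) =>
      Real.log (pol.dens x.2 x.1.1 x.1.2) :=
    (pol.measurable_dens.comp (measurable_snd.prodMk measurable_fst)).log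
  have h := measurable_fderiv_apply_of_hasFDerivAt
    (f := fun (x : S × A) θ => Real.log (pol.dens θ x.1 x.2)) hlog
    fun x θ => (hpol.differentiable x.1 x.2 θ).hasFDerivAt
  refine measurable_of_measurable_inner fun w => ?_
  simp only [real_inner_comm _ w, inner_gradient_left]
  exact h.comp (measurable_fst.prodMk (measurable_snd.prodMk measurable_const))

lemma measurable_gradient_apply {H : ℕ} (hpol : pol.Regular G L) (h : Fin H) :
    Measurable fun x : Traj S A H × EuclideanSpace ℝ (Fin d) =>
      gradient (fun θ => Real.log (pol.dens θ (x.1 h).1 (x.1 h).2)) x.2 := by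
  have hx : Measurable fun x : Traj S A H × EuclideanSpace ℝ (Fin d) => (x.1 h, x.2) :=
    ((measurable_pi_apply h).comp measurable_fst).prodMk measurable_snd
  exact hpol.measurable_gradient.comp hx

end ParamPolicy.Regular

namespace MDP

variable {S A : Type*} [MeasurableSpace S] [MeasurableSpace A] (M : MDP S A)
  {d H : ℕ} {ν : Measure A} {pol : ParamPolicy S A d ν} {R₀ G L : ℝ}

/-! ### Rewards -/

lemma measurable_reward (h : Fin H) :
    Measurable fun τ : Traj S A H => M.r (τ h).1 (τ h).2 :=
  M.measurable_r.comp (measurable_pi_apply h)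

lemma measurable_ret : Measurable fun τ : Traj S A H => M.ret τ :=
  Finset.measurable_fun_sum _ fun h _ => (M.measurable_reward h).const_mul _

lemma measurable_rewardToGo (h : Fin H) : Measurable fun τ : Traj S A H => M.rewardToGo h τ :=
  Finset.measurable_fun_sum _ fun h _ => (M.measurable_reward h).const_mul _

lemma abs_discounted_reward_le {M : MDP S A} (hr : M.BoundedReward R₀) (n : ℕ) (s : S) (a : A) :
    |M.γ ^ n * M.r s a| ≤ M.γ ^ n * R₀ := by
  rw [abs_mul, abs_of_nonneg (pow_nonneg M.γ_pos.le n)]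
  exact mul_le_mul_of_nonneg_left (hr s a).le (pow_nonneg M.γ_pos.le n)

lemma abs_ret_le {M : MDP S A} (hR₀ : 0 ≤ R₀) (hr : M.BoundedReward R₀) (τ : Traj S A H) :
    |M.ret τ| ≤ R₀ / (1 - M.γ) := by
  calc |M.ret τ| ≤ ∑ h : Fin H, M.γ ^ (h : ℕ) * R₀ :=
        (Finset.abs_sum_le_sum_abs _ _).trans
          (Finset.sum_le_sum fun h _ => abs_discounted_reward_le hr _ _ _)
    _ = (∑ i ∈ Finset.Ico 0 H, M.γ ^ i) * R₀ := by
        rw [← Finset.sum_mul, Fin.sum_univ_eq_sum_range (fun i => M.γ ^ i), Finset.range_eq_Ico]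
    _ ≤ M.γ ^ 0 / (1 - M.γ) * R₀ := by
        gcongr
        exact geom_sum_Ico_le_of_lt_one M.γ_pos.le M.γ_lt_one
    _ = R₀ / (1 - M.γ) := by ring

lemma abs_rewardToGo_le {M : MDP S A} (hR₀ : 0 ≤ R₀) (hr : M.BoundedReward R₀) (h : Fin H)
    (τ : Traj S A H) : |M.rewardToGo h τ| ≤ M.γ ^ (h : ℕ) * (R₀ / (1 - M.γ)) := by
  calc |M.rewardToGo h τ| ≤ ∑ t ∈ Finset.Ici h, M.γ ^ (t : ℕ) * R₀ :=
        (Finset.abs_sum_le_sum_abs _ _).trans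
          (Finset.sum_le_sum fun h _ => abs_discounted_reward_le hr _ _ _)
    _ = (∑ i ∈ Finset.Ico (h : ℕ) H, M.γ ^ i) * R₀ := by
        rw [← Finset.sum_mul, ← Fin.map_valEmbedding_Ici, Finset.sum_map]
        rfl
    _ ≤ M.γ ^ (h : ℕ) / (1 - M.γ) * R₀ := by
        gcongr
        exact geom_sum_Ico_le_of_lt_one M.γ_pos.le M.γ_lt_one
    _ = M.γ ^ (h : ℕ) * (R₀ / (1 - M.γ)) := by ring

/-- Two nested geometric series, one over the tail of rewards and one over `h`; squared, they
produce the `(1-γ)⁴` of `σ_g²` and `σ_B²`. -/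
lemma sum_rewardToGo_le {M : MDP S A} (hR₀ : 0 ≤ R₀) (hr : M.BoundedReward R₀) (τ : Traj S A H) :
    ∑ h, |M.rewardToGo h τ| ≤ R₀ / (1 - M.γ) ^ 2 := by
  have h1 : 0 < 1 - M.γ := sub_pos.2 M.γ_lt_one
  calc ∑ h, |M.rewardToGo h τ| ≤ ∑ h : Fin H, M.γ ^ (h : ℕ) * (R₀ / (1 - M.γ)) :=
        Finset.sum_le_sum fun h _ => abs_rewardToGo_le hR₀ hr h τ
    _ = (∑ i ∈ Finset.Ico 0 H, M.γ ^ i) * (R₀ / (1 - M.γ)) := by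
        rw [← Finset.sum_mul, Fin.sum_univ_eq_sum_range (fun i => M.γ ^ i), Finset.range_eq_Ico]
    _ ≤ M.γ ^ 0 / (1 - M.γ) * (R₀ / (1 - M.γ)) := by
        gcongr
        exact geom_sum_Ico_le_of_lt_one M.γ_pos.le M.γ_lt_one
    _ = R₀ / (1 - M.γ) ^ 2 := by field_simp

lemma ret_succ (τ : Traj S A (H + 1)) : M.ret τ = M.ret (Fin.init τ : Traj S A H) +
    M.γ ^ H * M.r (τ (Fin.last H)).1 (τ (Fin.last H)).2 := by
  simp [ret, Fin.sum_univ_castSucc, Fin.init]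

lemma rewardToGo_castSucc (h : Fin H) (τ : Traj S A (H + 1)) :
    M.rewardToGo h.castSucc τ = M.rewardToGo h (Fin.init τ : Traj S A H) +
      M.γ ^ H * M.r (τ (Fin.last H)).1 (τ (Fin.last H)).2 := by
  have h1 : Finset.Ici h.castSucc = Finset.univ.filter (h.castSucc ≤ ·) := by ext; simp
  have h2 : Finset.Ici h = Finset.univ.filter (h ≤ ·) := by ext; simp
  simp [rewardToGo, h1, h2, Finset.sum_filter, Fin.sum_univ_castSucc, Fin.init, Fin.le_last]

lemma rewardToGo_last (τ : Traj S A (H + 1)) : M.rewardToGo (Fin.last H) τ =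
      M.γ ^ H * M.r (τ (Fin.last H)).1 (τ (Fin.last H)).2 := by
  have h1 : Finset.Ici (Fin.last H) = {Fin.last H} := by ext; simp [Fin.last_le_iff]
  simp [rewardToGo, h1]

/-! ### Score function and estimators -/

lemma trajDens_pos (hpol : pol.Regular G L) (θ : EuclideanSpace ℝ (Fin d)) (τ : Traj S A H) :
    0 < trajDens pol θ τ := Finset.prod_pos fun _ _ => hpol.pos _ _ _

lemma hasGradientAt_log_trajDens (hpol : pol.Regular G L) (θ : EuclideanSpace ℝ (Fin d))
    (τ : Traj S A H) : HasGradientAt (fun θ' => Real.log (trajDens pol θ' τ))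
      (∑ h, gradient (fun θ' => Real.log (pol.dens θ' (τ h).1 (τ h).2)) θ) θ := by
  have : (fun θ' => Real.log (trajDens pol θ' τ)) =
      fun θ' => ∑ h, Real.log (pol.dens θ' (τ h).1 (τ h).2) := by
    funext θ'
    exact Real.log_prod fun h _ => (hpol.pos _ _ _).ne'
  rw [this, hasGradientAt_iff_hasFDerivAt, map_sum]
  exact HasFDerivAt.fun_sum fun h _ => (hpol.differentiable _ _ θ).hasGradientAt.hasFDerivAt

lemma gradient_log_trajDens (hpol : pol.Regular G L) (θ : EuclideanSpace ℝ (Fin d))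
    (τ : Traj S A H) : gradient (fun θ' => Real.log (trajDens pol θ' τ)) θ =
      ∑ h, gradient (fun θ' => Real.log (pol.dens θ' (τ h).1 (τ h).2)) θ :=
  (hasGradientAt_log_trajDens hpol θ τ).gradient

lemma norm_gradient_log_trajDens_le (hpol : pol.Regular G L) (θ : EuclideanSpace ℝ (Fin d))
    (τ : Traj S A H) : ‖gradient (fun θ' => Real.log (trajDens pol θ' τ)) θ‖ ≤ H * G := by
  rw [gradient_log_trajDens hpol]
  refine (norm_sum_le_of_le _ fun h _ => hpol.gradient_le θ _ _).trans ?_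
  simp

lemma measurable_gradient_log_trajDens (hpol : pol.Regular G L) :
    Measurable fun x : Traj S A H × EuclideanSpace ℝ (Fin d) =>
      gradient (fun θ' => Real.log (trajDens pol θ' x.1)) x.2 := by
  simp only [gradient_log_trajDens hpol]
  exact Finset.measurable_fun_sum _ fun h _ => hpol.measurable_gradient_apply h

lemma measurable_gradient_log_trajDens_right (hpol : pol.Regular G L)
    (θ : EuclideanSpace ℝ (Fin d)) :
    Measurable fun τ : Traj S A H => gradient (fun θ' => Real.log (trajDens pol θ' τ)) θ := by
  exact Measurable.of_uncurry_right
    (f := fun τ θ => gradient (fun θ' => Real.log (trajDens pol θ' τ)) θ)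
    (measurable_gradient_log_trajDens (H := H) hpol)

lemma hasFDerivAt_trajDens (hpol : pol.Regular G L) (θ : EuclideanSpace ℝ (Fin d))
    (τ : Traj S A H) : HasFDerivAt (fun θ' => trajDens pol θ' τ)
      (trajDens pol θ τ • innerSL ℝ (gradient (fun θ' => Real.log (trajDens pol θ' τ)) θ)) θ := by
  have h := (hasGradientAt_log_trajDens hpol θ τ).differentiableAt.hasGradientAt.hasFDerivAt.exp
  simpa only [Real.exp_log (trajDens_pos hpol _ τ), toDual_eq_innerSL] using h

/-- The log density is `H G`-Lipschitz in the parameter. This supplies the dominating function for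
differentiation under the integral. -/
lemma trajDens_le_exp_mul (hpol : pol.Regular G L) (θ θ' : EuclideanSpace ℝ (Fin d))
    (τ : Traj S A H) :
    trajDens pol θ' τ ≤ Real.exp (H * G * ‖θ' - θ‖) * trajDens pol θ τ := by
  have h := Convex.norm_image_sub_le_of_norm_hasFDerivWithin_le (s := Set.univ) (x := θ) (y := θ')
    (C := H * G) (fun x _ =>
      (hasGradientAt_log_trajDens hpol x τ).differentiableAt.hasGradientAt.hasFDerivAt.hasFDerivWithinAt)
    (fun x _ => by
      rw [LinearIsometryEquiv.norm_map]
      exact norm_gradient_log_trajDens_le hpol x τ) convex_univ trivial trivial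
  rw [← Real.log_le_log_iff (trajDens_pos hpol _ τ)
    (mul_pos (Real.exp_pos _) (trajDens_pos hpol _ τ)),
    Real.log_mul (Real.exp_pos _).ne' (trajDens_pos hpol _ τ).ne', Real.log_exp]
  linarith [(abs_le.1 h).2]

lemma hasGradientAt_Phi (hpol : pol.Regular G L) (θ : EuclideanSpace ℝ (Fin d))
    (τ : Traj S A H) : HasGradientAt (M.Phi pol τ) (M.gradEst pol τ θ) θ := by
  unfold Phi gradEst
  rw [hasGradientAt_iff_hasFDerivAt, map_sum]
  refine HasFDerivAt.fun_sum fun h _ => ?_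
  rw [map_smul]
  exact (hpol.differentiable _ _ θ).hasGradientAt.hasFDerivAt.const_mul _

lemma gradient_Phi (hpol : pol.Regular G L) (τ : Traj S A H) :
    gradient (M.Phi pol τ) = M.gradEst pol τ :=
  funext fun θ => (M.hasGradientAt_Phi hpol θ τ).gradient

lemma hasFDerivAt_gradEst (hpol : pol.Regular G L) (θ : EuclideanSpace ℝ (Fin d))
    (τ : Traj S A H) : HasFDerivAt (M.gradEst pol τ) (∑ h, M.rewardToGo h τ •
      fderiv ℝ (gradient fun θ' => Real.log (pol.dens θ' (τ h).1 (τ h).2)) θ) θ := by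
  unfold gradEst
  exact HasFDerivAt.fun_sum fun h _ =>
    (hpol.differentiable_gradient _ _ θ).hasFDerivAt.fun_const_smul _

lemma hessEst_eq (hpol : pol.Regular G L) (θ : EuclideanSpace ℝ (Fin d)) (τ : Traj S A H) :
    M.hessEst pol τ θ =
      (innerSL ℝ (gradient (fun θ' => Real.log (trajDens pol θ' τ)) θ)).smulRight
        (M.gradEst pol τ θ) + fderiv ℝ (M.gradEst pol τ) θ := by
  rw [hessEst, gradient_Phi M hpol]

lemma measurable_gradEst (hpol : pol.Regular G L) :
    Measurable fun x : Traj S A H × EuclideanSpace ℝ (Fin d) => M.gradEst pol x.1 x.2 := by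
  unfold gradEst
  exact Finset.measurable_fun_sum _ fun h _ =>
    ((M.measurable_rewardToGo h).comp measurable_fst).smul (hpol.measurable_gradient_apply h)

lemma measurable_fderiv_gradEst (hpol : pol.Regular G L) :
    Measurable fun x : Traj S A H × EuclideanSpace ℝ (Fin d) × EuclideanSpace ℝ (Fin d) =>
      fderiv ℝ (M.gradEst pol x.1) x.2.1 x.2.2 :=
  measurable_fderiv_apply_of_hasFDerivAt (M.measurable_gradEst hpol) fun τ θ =>
    (M.hasFDerivAt_gradEst hpol θ τ).differentiableAt.hasFDerivAt

lemma measurable_hessEst (hpol : pol.Regular G L) :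
    Measurable fun x : Traj S A H × EuclideanSpace ℝ (Fin d) × EuclideanSpace ℝ (Fin d) =>
      M.hessEst pol x.1 x.2.1 x.2.2 := by
  simp only [hessEst_eq M hpol, add_apply, ContinuousLinearMap.smulRight_apply,
    innerSL_apply_apply]
  have hx : Measurable fun x : Traj S A H × EuclideanSpace ℝ (Fin d) × EuclideanSpace ℝ (Fin d) =>
      (x.1, x.2.1) := measurable_fst.prodMk measurable_snd.fst
  exact ((Measurable.inner (𝕜 := ℝ) ((measurable_gradient_log_trajDens hpol).comp hx)
    measurable_snd.snd).smul
    ((M.measurable_gradEst hpol).comp hx)).add (M.measurable_fderiv_gradEst hpol)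

lemma measurable_gradEst_right (hpol : pol.Regular G L) (θ : EuclideanSpace ℝ (Fin d)) :
    Measurable fun τ : Traj S A H => M.gradEst pol τ θ := by
  exact Measurable.of_uncurry_right
    (f := fun τ θ => M.gradEst pol τ θ)
    (M.measurable_gradEst (H := H) hpol)

lemma measurable_hessEst_right (hpol : pol.Regular G L) (θ w : EuclideanSpace ℝ (Fin d)) :
    Measurable fun τ : Traj S A H => M.hessEst pol τ θ w := by
  exact Measurable.of_uncurry_right
    (f := fun (τ : Traj S A H) (x : EuclideanSpace ℝ (Fin d) × EuclideanSpace ℝ (Fin d)) =>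
      M.hessEst pol τ x.1 x.2) (y := (θ, w)) (M.measurable_hessEst hpol)

variable {M}

lemma norm_gradEst_le (hR₀ : 0 ≤ R₀) (hG : 0 ≤ G) (hr : M.BoundedReward R₀)
    (hpol : pol.Regular G L) (τ : Traj S A H) (θ : EuclideanSpace ℝ (Fin d)) :
    ‖M.gradEst pol τ θ‖ ≤ G * (R₀ / (1 - M.γ) ^ 2) := by
  calc ‖M.gradEst pol τ θ‖ ≤ ∑ h, |M.rewardToGo h τ| * G := by
        refine norm_sum_le_of_le _ fun h _ => ?_
        rw [norm_smul, Real.norm_eq_abs]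
        gcongr
        exact hpol.gradient_le _ _ _
    _ ≤ R₀ / (1 - M.γ) ^ 2 * G := by
        rw [← Finset.sum_mul]
        gcongr
        exact sum_rewardToGo_le hR₀ hr τ
    _ = _ := mul_comm _ _

lemma norm_fderiv_gradEst_le (hR₀ : 0 ≤ R₀) (hL : 0 ≤ L) (hr : M.BoundedReward R₀)
    (hpol : pol.Regular G L) (τ : Traj S A H) (θ : EuclideanSpace ℝ (Fin d)) :
    ‖fderiv ℝ (M.gradEst pol τ) θ‖ ≤ L * (R₀ / (1 - M.γ) ^ 2) := by
  rw [(M.hasFDerivAt_gradEst hpol θ τ).fderiv]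
  calc _ ≤ ∑ h, |M.rewardToGo h τ| * L := by
        refine norm_sum_le_of_le _ fun h _ => ?_
        rw [norm_smul, Real.norm_eq_abs]
        gcongr
        exact hpol.hessian_le _ _ _
    _ ≤ R₀ / (1 - M.γ) ^ 2 * L := by
        rw [← Finset.sum_mul]
        gcongr
        exact sum_rewardToGo_le hR₀ hr τ
    _ = _ := mul_comm _ _

lemma norm_hessEst_le (hR₀ : 0 ≤ R₀) (hG : 0 ≤ G) (hL : 0 ≤ L) (hr : M.BoundedReward R₀)
    (hpol : pol.Regular G L) (τ : Traj S A H) (θ : EuclideanSpace ℝ (Fin d)) :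
    ‖M.hessEst pol τ θ‖ ≤ (H * G ^ 2 + L) * (R₀ / (1 - M.γ) ^ 2) := by
  rw [hessEst_eq M hpol]
  calc _ ≤ H * G * (G * (R₀ / (1 - M.γ) ^ 2)) + L * (R₀ / (1 - M.γ) ^ 2) := by
        refine norm_add_le_of_le ?_ (norm_fderiv_gradEst_le hR₀ hL hr hpol τ θ)
        rw [ContinuousLinearMap.norm_smulRight_apply, innerSL_apply_norm]
        gcongr
        · exact norm_gradient_log_trajDens_le hpol θ τ
        · exact norm_gradEst_le hR₀ hG hr hpol τ θ
    _ = _ := by ring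

end MDP

end

noncomputable section

namespace MDP

variable {S A : Type*} [MeasurableSpace S] [MeasurableSpace A] {M : MDP S A}
  {d H : ℕ} {ν : Measure A} {pol : ParamPolicy S A d ν} {R₀ G L : ℝ}

/-! ### Derivatives of expectations over trajectories -/

lemma integral_trajLaw {V : Type*} [NormedAddCommGroup V] [NormedSpace ℝ V]
    (f : Traj S A H → V) (θ : EuclideanSpace ℝ (Fin d)) :
    ∫ τ, f τ ∂(M.trajLaw pol H θ) = ∫ τ, trajDens pol θ τ • f τ ∂(M.trajBase ν H) := by
  rw [trajLaw, integral_withDensity_eq_integral_toReal_smul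
    (measurable_trajDens pol θ).ennreal_ofReal (by simp)]
  simp only [ENNReal.toReal_ofReal (trajDens_nonneg pol θ _)]

/-- The new last reward enters every reward-to-go, so its coefficients add up to the full score of
the longer trajectory. -/
lemma gradEst_succ (hpol : pol.Regular G L) (τ : Traj S A (H + 1))
    (θ : EuclideanSpace ℝ (Fin d)) :
    M.gradEst pol τ θ = M.gradEst pol (Fin.init τ : Traj S A H) θ +
      (M.γ ^ H * M.r (τ (Fin.last H)).1 (τ (Fin.last H)).2) •
        gradient (fun θ' => Real.log (trajDens pol θ' τ)) θ := by
  rw [gradient_log_trajDens hpol]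
  simp only [gradEst, Fin.sum_univ_castSucc, rewardToGo_castSucc, rewardToGo_last, add_smul,
    smul_add, Finset.sum_add_distrib, Finset.smul_sum, add_assoc]
  rfl

variable [SFinite ν]

variable (M) in
lemma integrable_trajDens (θ : EuclideanSpace ℝ (Fin d)) :
    Integrable (fun τ : Traj S A H => trajDens pol θ τ) (M.trajBase ν H) := by
  refine ⟨(measurable_trajDens pol θ).aestronglyMeasurable, ?_⟩
  have h : ∫⁻ τ, ENNReal.ofReal (trajDens pol θ τ) ∂(M.trajBase ν H) = 1 := by
    have := measure_univ (μ := M.trajLaw pol H θ)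
    rwa [trajLaw, withDensity_apply _ MeasurableSet.univ, Measure.restrict_univ] at this
  rw [hasFiniteIntegral_iff_ofReal (Filter.Eventually.of_forall fun τ => trajDens_nonneg pol θ τ),
    h]
  exact ENNReal.one_lt_top

variable (M) in
/-- The likelihood-ratio formula for the derivative of `θ ↦ 𝔼_{τ ∼ p(· | π_θ)} F(τ, θ)`. -/
theorem hasFDerivAt_integral_trajLaw {V : Type*} [NormedAddCommGroup V] [NormedSpace ℝ V]
    [MeasurableSpace V] [BorelSpace V] [SecondCountableTopology V]
    (hpol : pol.Regular G L) {F : Traj S A H → EuclideanSpace ℝ (Fin d) → V}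
    {F' : Traj S A H → EuclideanSpace ℝ (Fin d) → EuclideanSpace ℝ (Fin d) →L[ℝ] V} {C C' : ℝ}
    (hF : Measurable fun x : Traj S A H × EuclideanSpace ℝ (Fin d) => F x.1 x.2)
    (hF' : ∀ τ θ, HasFDerivAt (F τ) (F' τ θ) θ) (hC : ∀ τ θ, ‖F τ θ‖ ≤ C)
    (hC' : ∀ τ θ, ‖F' τ θ‖ ≤ C') (θ : EuclideanSpace ℝ (Fin d)) :
    HasFDerivAt (fun θ => ∫ τ, F τ θ ∂(M.trajLaw pol H θ))
      (∫ τ, ((innerSL ℝ (gradient (fun θ' => Real.log (trajDens pol θ' τ)) θ)).smulRight (F τ θ)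
        + F' τ θ) ∂(M.trajLaw pol H θ)) θ := by
  simp only [integral_trajLaw]
  have hFm : ∀ θ, Measurable fun τ => F τ θ := fun θ =>
    hF.comp (measurable_id.prodMk measurable_const)
  refine hasFDerivAt_integral_of_dominated_of_fderiv_le
    (F' := fun θ τ => trajDens pol θ τ •
      ((innerSL ℝ (gradient (fun θ' => Real.log (trajDens pol θ' τ)) θ)).smulRight (F τ θ)
        + F' τ θ))
    -- On the unit ball the density is at most `exp (H G)` times its value at the centre, and the
    -- remaining factor is at most `H G C + C'`.
    (bound := fun τ => Real.exp (H * G) * (H * G * C + C') * trajDens pol θ τ)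
    (Metric.ball_mem_nhds θ one_pos)
    (Filter.Eventually.of_forall fun θ =>
      ((measurable_trajDens pol θ).smul (hFm θ)).aestronglyMeasurable)
    ?_ ?_ ?_ ((M.integrable_trajDens θ).const_mul _) ?_
  · exact (M.integrable_trajDens θ).smul_bdd _ (hFm θ).aestronglyMeasurable
      (Filter.Eventually.of_forall fun τ => hC τ θ)
  · refine (stronglyMeasurable_clm_of_measurable_apply fun w => ?_).aestronglyMeasurable
    simp only [smul_apply, add_apply, ContinuousLinearMap.smulRight_apply, innerSL_apply_apply]
    have hx : Measurable fun τ : Traj S A H => (τ, θ, w) := measurable_id.prodMk measurable_const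
    have hF'w : Measurable fun τ : Traj S A H => F' τ θ w :=
      (measurable_fderiv_apply_of_hasFDerivAt hF hF').comp hx
    exact (measurable_trajDens pol θ).smul ((((measurable_gradient_log_trajDens_right hpol θ).inner
      measurable_const).smul (hFm θ)).add hF'w)
  · refine Filter.Eventually.of_forall fun τ x hx => ?_
    have hHG : 0 ≤ H * G := (norm_nonneg _).trans (norm_gradient_log_trajDens_le hpol θ τ)
    have hC0 : 0 ≤ C := (norm_nonneg _).trans (hC τ θ)
    have hC0' : 0 ≤ C' := (norm_nonneg _).trans (hC' τ θ)
    have h1 : trajDens pol x τ ≤ Real.exp (H * G) * trajDens pol θ τ := by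
      have hx1 : ‖x - θ‖ ≤ 1 := by simpa [dist_eq_norm] using (Metric.mem_ball.1 hx).le
      refine (trajDens_le_exp_mul hpol θ x τ).trans
        (mul_le_mul_of_nonneg_right ?_ (trajDens_nonneg pol θ τ))
      exact Real.exp_le_exp.2 (mul_le_of_le_one_right hHG hx1)
    have h2 : ‖(innerSL ℝ (gradient (fun θ' => Real.log (trajDens pol θ' τ)) x)).smulRight (F τ x)
        + F' τ x‖ ≤ H * G * C + C' := by
      refine norm_add_le_of_le ?_ (hC' τ x)
      rw [ContinuousLinearMap.norm_smulRight_apply, innerSL_apply_norm]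
      exact mul_le_mul (norm_gradient_log_trajDens_le hpol x τ) (hC τ x) (norm_nonneg _) hHG
    rw [norm_smul, Real.norm_of_nonneg (trajDens_nonneg pol x τ)]
    calc _ ≤ (Real.exp (H * G) * trajDens pol θ τ) * (H * G * C + C') :=
          mul_le_mul h1 h2 (norm_nonneg _) ((trajDens_nonneg pol x τ).trans h1)
      _ = _ := by ring
  · refine Filter.Eventually.of_forall fun τ x _ => ?_
    refine ((hasFDerivAt_trajDens hpol x τ).smul (hF' τ x)).congr_fderiv
      (ContinuousLinearMap.ext fun w => ?_)
    simp only [add_apply, smul_apply, ContinuousLinearMap.smulRight_apply, smul_add, smul_smul,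
      smul_eq_mul]
    exact add_comm _ _

lemma integrable_gradEst (hR₀ : 0 ≤ R₀) (hG : 0 ≤ G) (hr : M.BoundedReward R₀)
    (hpol : pol.Regular G L) (θ θ' : EuclideanSpace ℝ (Fin d)) :
    Integrable (fun τ => M.gradEst pol τ θ) (M.trajLaw pol H θ') :=
  Integrable.of_bound (M.measurable_gradEst_right hpol θ).aestronglyMeasurable _
    (Filter.Eventually.of_forall fun τ => norm_gradEst_le hR₀ hG hr hpol τ θ)

/-- The policy gradient theorem. -/
theorem hasGradientAt_J (hR₀ : 0 ≤ R₀) (hG : 0 ≤ G) (hr : M.BoundedReward R₀)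
    (hpol : pol.Regular G L) (θ : EuclideanSpace ℝ (Fin d)) :
    HasGradientAt (M.J pol H) (∫ τ, M.gradEst pol τ θ ∂(M.trajLaw pol H θ)) θ := by
  -- Adding one reward at a time, each reward is differentiated under the law of the trajectory that
  -- ends with it. It never meets scores of later actions, so their zero mean need not be invoked.
  induction H with
  | zero =>
    have h1 : M.J pol 0 = fun _ => 0 := by funext; simp [J, ret]
    have h2 : ∀ τ : Traj S A 0, M.gradEst pol τ θ = 0 := fun τ => by simp [gradEst]
    simp only [h1, h2, integral_zero]
    exact hasGradientAt_const _ _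
  | succ n ih =>
    have hm : Measurable fun τ : Traj S A (n + 1) =>
        M.γ ^ n * M.r (τ (Fin.last n)).1 (τ (Fin.last n)).2 :=
      (M.measurable_reward _).const_mul _
    have hb : ∀ τ : Traj S A (n + 1), ‖M.γ ^ n * M.r (τ (Fin.last n)).1 (τ (Fin.last n)).2‖
        ≤ M.γ ^ n * R₀ := fun τ => abs_discounted_reward_le hr _ _ _
    have hJ : M.J pol (n + 1) = fun θ => M.J pol n θ +
        ∫ τ, M.γ ^ n * M.r (τ (Fin.last n)).1 (τ (Fin.last n)).2 ∂(M.trajLaw pol (n + 1) θ) := by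
      funext θ
      have hret : Measurable fun τ : Traj S A n => M.ret τ := M.measurable_ret
      simp only [J, ret_succ]
      rw [integral_add, integral_trajLaw_succ_init M pol n θ hret.aestronglyMeasurable]
      · exact Integrable.of_bound (hret.comp (measurable_init n)).aestronglyMeasurable _
          (Filter.Eventually.of_forall fun τ => abs_ret_le hR₀ hr _)
      · exact Integrable.of_bound hm.aestronglyMeasurable _ (Filter.Eventually.of_forall hb)
    have hscore : Integrable (fun τ : Traj S A (n + 1) =>
        (M.γ ^ n * M.r (τ (Fin.last n)).1 (τ (Fin.last n)).2) •
          gradient (fun θ' => Real.log (trajDens pol θ' τ)) θ) (M.trajLaw pol (n + 1) θ) := by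
      refine Integrable.of_bound
        (hm.smul (measurable_gradient_log_trajDens_right hpol θ)).aestronglyMeasurable
        (M.γ ^ n * R₀ * (((n + 1 : ℕ) : ℝ) * G)) (Filter.Eventually.of_forall fun τ => ?_)
      rw [norm_smul]
      exact mul_le_mul (hb τ) (norm_gradient_log_trajDens_le hpol θ τ) (norm_nonneg _)
        ((norm_nonneg _).trans (hb τ))
    -- The last reward does not depend on the parameter, so only the score term survives.
    have hD := M.hasFDerivAt_integral_trajLaw (H := n + 1) hpol
      (F := fun τ _ => M.γ ^ n * M.r (τ (Fin.last n)).1 (τ (Fin.last n)).2) (F' := fun _ _ => 0)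
      (hm.comp measurable_fst) (fun τ θ => hasFDerivAt_const _ _) (fun τ _ => hb τ)
      (fun _ _ => norm_zero.le) θ
    rw [hasGradientAt_iff_hasFDerivAt, hJ]
    have hg := integrable_gradEst (H := n) hR₀ hG hr hpol θ θ
    have hg' : Integrable (fun τ : Traj S A (n + 1) =>
        M.gradEst pol (Fin.init τ : Traj S A n) θ) (M.trajLaw pol (n + 1) θ) := by
      have h := hg
      rw [← map_init_trajLaw M pol n θ] at h
      exact h.comp_measurable (measurable_init n)
    have hInt : ∫ τ : Traj S A (n + 1), M.gradEst pol τ θ ∂(M.trajLaw pol (n + 1) θ) =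
        (∫ τ, M.gradEst pol τ θ ∂(M.trajLaw pol n θ)) +
          ∫ τ, (M.γ ^ n * M.r (τ (Fin.last n)).1 (τ (Fin.last n)).2) •
            gradient (fun θ' => Real.log (trajDens pol θ' τ)) θ ∂(M.trajLaw pol (n + 1) θ) := by
      rw [← integral_trajLaw_succ_init M pol n θ (f := fun τ => M.gradEst pol τ θ)
        hg.aestronglyMeasurable, ← integral_add hg' hscore]
      exact integral_congr_ae (Filter.Eventually.of_forall fun τ => gradEst_succ hpol τ θ)
    rw [hInt, map_add, toDual_eq_innerSL (∫ τ, _ ∂(M.trajLaw pol (n + 1) θ)),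
      ← ContinuousLinearMap.integral_comp_comm _ hscore]
    refine (ih.hasFDerivAt.add hD).congr_fderiv (congrArg _ ?_)
    refine integral_congr_ae (Filter.Eventually.of_forall fun τ => ContinuousLinearMap.ext fun w => ?_)
    simp only [add_zero, ContinuousLinearMap.smulRight_apply, innerSL_apply_apply, smul_eq_mul]
    exact (mul_comm _ _).trans (real_inner_smul_left _ _ _).symm

lemma gradient_J (hR₀ : 0 ≤ R₀) (hG : 0 ≤ G) (hr : M.BoundedReward R₀)
    (hpol : pol.Regular G L) :
    gradient (M.J pol H) = fun θ => ∫ τ, M.gradEst pol τ θ ∂(M.trajLaw pol H θ) :=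
  gradient_eq fun θ => hasGradientAt_J hR₀ hG hr hpol θ

/-- The likelihood-ratio formula is applied a second time, now to the parameter-dependent integrand
`g`; its two terms are exactly those of `B`. -/
theorem hasFDerivAt_gradient_J (hR₀ : 0 ≤ R₀) (hG : 0 ≤ G) (hL : 0 ≤ L) (hr : M.BoundedReward R₀)
    (hpol : pol.Regular G L) (θ : EuclideanSpace ℝ (Fin d)) :
    HasFDerivAt (gradient (M.J pol H)) (∫ τ, M.hessEst pol τ θ ∂(M.trajLaw pol H θ)) θ := by
  rw [gradient_J hR₀ hG hr hpol]
  simp only [hessEst_eq M hpol]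
  exact M.hasFDerivAt_integral_trajLaw hpol (M.measurable_gradEst hpol)
    (fun τ θ => (M.hasFDerivAt_gradEst hpol θ τ).differentiableAt.hasFDerivAt)
    (norm_gradEst_le hR₀ hG hr hpol) (norm_fderiv_gradEst_le hR₀ hL hr hpol) θ

lemma integrable_hessEst (hR₀ : 0 ≤ R₀) (hG : 0 ≤ G) (hL : 0 ≤ L) (hr : M.BoundedReward R₀)
    (hpol : pol.Regular G L) (θ θ' : EuclideanSpace ℝ (Fin d)) :
    Integrable (fun τ => M.hessEst pol τ θ) (M.trajLaw pol H θ') := by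
  refine Integrable.of_bound (stronglyMeasurable_clm_of_measurable_apply
    fun w => ?_).aestronglyMeasurable _
    (Filter.Eventually.of_forall fun τ => norm_hessEst_le hR₀ hG hL hr hpol τ θ)
  exact M.measurable_hessEst_right hpol θ w

lemma abs_J_le (hR₀ : 0 ≤ R₀) (hr : M.BoundedReward R₀) (θ : EuclideanSpace ℝ (Fin d)) :
    |M.J pol H θ| ≤ R₀ / (1 - M.γ) := by
  simpa [J] using norm_integral_le_of_norm_le_const (μ := M.trajLaw pol H θ) (f := M.ret)
    (Filter.Eventually.of_forall fun τ => abs_ret_le hR₀ hr τ)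

lemma norm_gradient_J_le (hR₀ : 0 ≤ R₀) (hG : 0 ≤ G) (hr : M.BoundedReward R₀)
    (hpol : pol.Regular G L) (θ : EuclideanSpace ℝ (Fin d)) :
    ‖gradient (M.J pol H) θ‖ ≤ G * (R₀ / (1 - M.γ) ^ 2) := by
  rw [gradient_J hR₀ hG hr hpol]
  simpa using norm_integral_le_of_norm_le_const (μ := M.trajLaw pol H θ)
    (Filter.Eventually.of_forall fun τ => norm_gradEst_le hR₀ hG hr hpol τ θ)

lemma norm_integral_hessEst_le (hR₀ : 0 ≤ R₀) (hG : 0 ≤ G) (hL : 0 ≤ L) (hr : M.BoundedReward R₀)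
    (hpol : pol.Regular G L) (θ : EuclideanSpace ℝ (Fin d)) :
    ‖∫ τ, M.hessEst pol τ θ ∂(M.trajLaw pol H θ)‖ ≤ (H * G ^ 2 + L) * (R₀ / (1 - M.γ) ^ 2) := by
  simpa using norm_integral_le_of_norm_le_const (μ := M.trajLaw pol H θ)
    (Filter.Eventually.of_forall fun τ => norm_hessEst_le hR₀ hG hL hr hpol τ θ)

lemma norm_gradient_J_sub_le (hR₀ : 0 ≤ R₀) (hG : 0 ≤ G) (hL : 0 ≤ L) (hr : M.BoundedReward R₀)
    (hpol : pol.Regular G L) (θ θ' : EuclideanSpace ℝ (Fin d)) :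
    ‖gradient (M.J pol H) θ' - gradient (M.J pol H) θ‖ ≤
      (H * G ^ 2 + L) * (R₀ / (1 - M.γ) ^ 2) * ‖θ' - θ‖ :=
  Convex.norm_image_sub_le_of_norm_hasFDerivWithin_le (s := Set.univ)
    (fun x _ => (hasFDerivAt_gradient_J hR₀ hG hL hr hpol x).hasFDerivWithinAt)
    (fun x _ => norm_integral_hessEst_le hR₀ hG hL hr hpol x) convex_univ trivial trivial

end MDP

end

noncomputable section

/-! ### One sampling step -/

instance isProbabilityMeasure_volume_restrict_Icc_zero_one :
    IsProbabilityMeasure (volume.restrict (Set.Icc (0 : ℝ) 1)) := ⟨by simp⟩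

namespace MDP

variable {S A : Type*} [MeasurableSpace S] [MeasurableSpace A] (M : MDP S A)
  {d H : ℕ} {ν : Measure A} {pol : ParamPolicy S A d ν} {R₀ G L : ℝ}

/-- The stochastic part of the SHARP update with momentum weight `α`, as a function of
`p = (θ_t, θ_{t-1})` and `x = (b_t, τ_t, τ_t^b)`. -/
def sharpIncrement (M : MDP S A) (pol : ParamPolicy S A d ν) (α : ℝ)
    (p : EuclideanSpace ℝ (Fin d) × EuclideanSpace ℝ (Fin d)) (x : ℝ × Traj S A H × Traj S A H) :
    EuclideanSpace ℝ (Fin d) :=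
  (1 - α) • M.hessEst pol x.2.2 (x.1 • p.1 + (1 - x.1) • p.2) (p.1 - p.2) +
    α • M.gradEst pol x.2.1 p.1

lemma measurable_sharpIncrement (hpol : pol.Regular G L) (α : ℝ) :
    Measurable fun z : (EuclideanSpace ℝ (Fin d) × EuclideanSpace ℝ (Fin d)) ×
      (ℝ × Traj S A H × Traj S A H) => M.sharpIncrement pol α z.1 z.2 := by
  have h1 : Measurable fun z : (EuclideanSpace ℝ (Fin d) × EuclideanSpace ℝ (Fin d)) ×
      (ℝ × Traj S A H × Traj S A H) =>
      (z.2.2.2, z.2.1 • z.1.1 + (1 - z.2.1) • z.1.2, z.1.1 - z.1.2) := by fun_prop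
  have h2 : Measurable fun z : (EuclideanSpace ℝ (Fin d) × EuclideanSpace ℝ (Fin d)) ×
      (ℝ × Traj S A H × Traj S A H) => (z.2.2.1, z.1.1) := by fun_prop
  have h3 := (M.measurable_hessEst (H := H) hpol).comp h1
  have h4 := (M.measurable_gradEst (H := H) hpol).comp h2
  exact (h3.const_smul (1 - α)).add (h4.const_smul α)

lemma norm_sharpIncrement_le {M : MDP S A} (hR₀ : 0 ≤ R₀) (hG : 0 ≤ G) (hL : 0 ≤ L)
    (hr : M.BoundedReward R₀) (hpol : pol.Regular G L) {α : ℝ} (hα : 0 ≤ α) (hα' : α ≤ 1)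
    (p : EuclideanSpace ℝ (Fin d) × EuclideanSpace ℝ (Fin d)) (x : ℝ × Traj S A H × Traj S A H) :
    ‖M.sharpIncrement pol α p x‖ ≤
      (1 - α) * ((H * G ^ 2 + L) * (R₀ / (1 - M.γ) ^ 2) * ‖p.1 - p.2‖) +
        α * (G * (R₀ / (1 - M.γ) ^ 2)) := by
  refine norm_add_le_of_le ?_ ?_
  · rw [norm_smul, Real.norm_of_nonneg (sub_nonneg.2 hα')]
    refine mul_le_mul_of_nonneg_left ?_ (sub_nonneg.2 hα')
    exact ContinuousLinearMap.le_of_opNorm_le _ (norm_hessEst_le hR₀ hG hL hr hpol _ _) _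
  · rw [norm_smul, Real.norm_of_nonneg hα]
    exact mul_le_mul_of_nonneg_left (norm_gradEst_le hR₀ hG hr hpol _ _) hα

variable (pol) [SFinite ν]

lemma measurable_segmentPoint : Measurable
    fun p : (EuclideanSpace ℝ (Fin d) × EuclideanSpace ℝ (Fin d)) × ℝ =>
      p.2 • p.1.1 + (1 - p.2) • p.1.2 := by
  fun_prop

/-- The joint law of `(b_t, τ_t, τ_t^b)` given `(θ_t, θ_{t-1})`. -/
def sampleKernel (H : ℕ) : Kernel (EuclideanSpace ℝ (Fin d) × EuclideanSpace ℝ (Fin d))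
    (ℝ × Traj S A H × Traj S A H) :=
  Kernel.const _ (volume.restrict (Set.Icc (0 : ℝ) 1)) ⊗ₖ
    ((M.trajKernel pol H).comap (fun p => p.1.1) measurable_fst.fst ×ₖ
      (M.trajKernel pol H).comap _ measurable_segmentPoint)

instance isMarkovKernel_sampleKernel : IsMarkovKernel (M.sampleKernel pol H) := by
  unfold sampleKernel
  infer_instance

lemma lintegral_sampleKernel (p : EuclideanSpace ℝ (Fin d) × EuclideanSpace ℝ (Fin d))
    {f : ℝ × Traj S A H × Traj S A H → ℝ≥0∞} (hf : Measurable f) :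
    ∫⁻ x, f x ∂(M.sampleKernel pol H p) = ∫⁻ u in Set.Icc (0 : ℝ) 1, ∫⁻ y, ∫⁻ y', f (u, y, y')
      ∂(M.trajLaw pol H (u • p.1 + (1 - u) • p.2)) ∂(M.trajLaw pol H p.1) := by
  rw [sampleKernel, Kernel.lintegral_compProd _ _ _ hf, Kernel.const_apply]
  refine lintegral_congr fun u => ?_
  rw [Kernel.prod_apply]
  exact lintegral_prod _ (hf.comp measurable_prodMk_left).aemeasurable

lemma integral_sampleKernel {V : Type*} [NormedAddCommGroup V] [NormedSpace ℝ V] [CompleteSpace V]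
    (p : EuclideanSpace ℝ (Fin d) × EuclideanSpace ℝ (Fin d))
    {f : ℝ → Traj S A H → V} {g : Traj S A H → V}
    (hf : Integrable (fun x : ℝ × Traj S A H × Traj S A H => f x.1 x.2.2) (M.sampleKernel pol H p))
    (hg : Integrable (fun x : ℝ × Traj S A H × Traj S A H => g x.2.1) (M.sampleKernel pol H p)) :
    ∫ x, (f x.1 x.2.2 + g x.2.1) ∂(M.sampleKernel pol H p) =
      (∫ u in Set.Icc (0 : ℝ) 1, ∫ y, f u y ∂(M.trajLaw pol H (u • p.1 + (1 - u) • p.2))) +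
        ∫ y, g y ∂(M.trajLaw pol H p.1) := by
  rw [integral_add hf hg]
  unfold sampleKernel at hf hg ⊢
  rw [ProbabilityTheory.integral_compProd hf, ProbabilityTheory.integral_compProd hg]
  simp only [Kernel.prod_apply, Kernel.const_apply, Kernel.comap_apply, trajKernel_apply,
    integral_fun_fst, integral_fun_snd, probReal_univ, one_smul, integral_const]

variable {M pol}

/-- Fundamental theorem of calculus for `u ↦ ∇J(uθ + (1-u)θ')`. A uniform `b_t` thus makes the
Hessian correction exactly unbiased, without any regularity of `∇²J`. -/
lemma integral_hessEst_segment (hR₀ : 0 ≤ R₀) (hG : 0 ≤ G) (hL : 0 ≤ L) (hr : M.BoundedReward R₀)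
    (hpol : pol.Regular G L) (θ θ' : EuclideanSpace ℝ (Fin d)) :
    ∫ u in Set.Icc (0 : ℝ) 1, ∫ τ, M.hessEst pol τ (u • θ + (1 - u) • θ') (θ - θ')
      ∂(M.trajLaw pol H (u • θ + (1 - u) • θ')) =
      gradient (M.J pol H) θ - gradient (M.J pol H) θ' := by
  set f : ℝ → EuclideanSpace ℝ (Fin d) := fun u =>
    gradient (M.J pol H) (u • θ + (1 - u) • θ') with hf
  have hderiv : ∀ u, HasDerivAt f (∫ τ, M.hessEst pol τ (u • θ + (1 - u) • θ') (θ - θ')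
      ∂(M.trajLaw pol H (u • θ + (1 - u) • θ'))) u := by
    intro u
    rw [← ContinuousLinearMap.integral_apply (integrable_hessEst hR₀ hG hL hr hpol _ _)]
    have h1 : HasDerivAt (fun u : ℝ => u • θ) ((1 : ℝ) • θ) u := (hasDerivAt_id u).smul_const θ
    have h2 : HasDerivAt (fun u : ℝ => (1 - u) • θ') ((-1 : ℝ) • θ') u :=
      ((hasDerivAt_id u).const_sub 1).smul_const θ'
    have h3 : HasDerivAt (fun u : ℝ => u • θ + (1 - u) • θ') (θ - θ') u :=
      (h1.fun_add h2).congr_deriv (by rw [one_smul, neg_one_smul, sub_eq_add_neg])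
    exact HasFDerivAt.comp_hasDerivAt (f := fun u : ℝ => u • θ + (1 - u) • θ') u
      (hasFDerivAt_gradient_J hR₀ hG hL hr hpol _) h3
  have hm : Measurable fun u : ℝ => ∫ τ, M.hessEst pol τ (u • θ + (1 - u) • θ') (θ - θ')
      ∂(M.trajLaw pol H (u • θ + (1 - u) • θ')) := by
    -- Continuity of the Hessian is not assumed; measurability comes from the integrand being a
    -- derivative.
    rw [show (fun u : ℝ => ∫ τ, M.hessEst pol τ (u • θ + (1 - u) • θ') (θ - θ')
      ∂(M.trajLaw pol H (u • θ + (1 - u) • θ'))) = deriv f from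
      funext fun u => (hderiv u).deriv.symm]
    exact measurable_deriv f
  rw [integral_Icc_eq_integral_Ioc, ← intervalIntegral.integral_of_le zero_le_one,
    intervalIntegral.integral_eq_sub_of_hasDerivAt (fun u _ => hderiv u)]
  · simp [hf]
  · rw [intervalIntegrable_iff, Set.uIoc_of_le zero_le_one]
    refine Integrable.of_bound hm.aestronglyMeasurable
      ((H * G ^ 2 + L) * (R₀ / (1 - M.γ) ^ 2) * ‖θ - θ'‖) (Filter.Eventually.of_forall fun u => ?_)
    rw [← ContinuousLinearMap.integral_apply (integrable_hessEst hR₀ hG hL hr hpol _ _)]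
    exact ContinuousLinearMap.le_of_opNorm_le _ (norm_integral_hessEst_le hR₀ hG hL hr hpol _) _

/-- The mean equals `∇J(θ_t) - (1-α) ∇J(θ_{t-1})`, precisely what makes the conditional mean of the
new error `(1-α)` times the old one. -/
lemma integral_sharpIncrement (hR₀ : 0 ≤ R₀) (hG : 0 ≤ G) (hL : 0 ≤ L) (hr : M.BoundedReward R₀)
    (hpol : pol.Regular G L) (α : ℝ) (p : EuclideanSpace ℝ (Fin d) × EuclideanSpace ℝ (Fin d)) :
    ∫ x, M.sharpIncrement pol α p x ∂(M.sampleKernel pol H p) =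
      (1 - α) • (gradient (M.J pol H) p.1 - gradient (M.J pol H) p.2) +
        α • gradient (M.J pol H) p.1 := by
  have h1 : Measurable fun x : ℝ × Traj S A H × Traj S A H =>
      (x.2.2, x.1 • p.1 + (1 - x.1) • p.2, p.1 - p.2) := by fun_prop
  have h2 : Measurable fun x : ℝ × Traj S A H × Traj S A H => (x.2.1, p.1) := by fun_prop
  have h3 := (M.measurable_hessEst (H := H) hpol).comp h1
  have h4 := (M.measurable_gradEst (H := H) hpol).comp h2
  have i1 : Integrable (fun x : ℝ × Traj S A H × Traj S A H =>
      M.hessEst pol x.2.2 (x.1 • p.1 + (1 - x.1) • p.2) (p.1 - p.2)) (M.sampleKernel pol H p) :=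
    Integrable.of_bound h3.aestronglyMeasurable
      ((H * G ^ 2 + L) * (R₀ / (1 - M.γ) ^ 2) * ‖p.1 - p.2‖) (Filter.Eventually.of_forall fun u =>
      ContinuousLinearMap.le_of_opNorm_le _ (norm_hessEst_le hR₀ hG hL hr hpol _ _) _)
  have i2 : Integrable (fun x : ℝ × Traj S A H × Traj S A H => M.gradEst pol x.2.1 p.1)
      (M.sampleKernel pol H p) :=
    Integrable.of_bound h4.aestronglyMeasurable _ (Filter.Eventually.of_forall fun u =>
      norm_gradEst_le hR₀ hG hr hpol _ _)
  unfold sharpIncrement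
  rw [integral_sampleKernel M pol p
    (f := fun u y => (1 - α) • M.hessEst pol y (u • p.1 + (1 - u) • p.2) (p.1 - p.2))
    (g := fun y => α • M.gradEst pol y p.1) (i1.smul (1 - α)) (i2.smul α)]
  simp only [integral_smul]
  rw [integral_hessEst_segment hR₀ hG hL hr hpol, gradient_J hR₀ hG hr hpol]

end MDP

/-! ### Samples of a run conditionally on the past -/

namespace IsSharpRun

open MDP

variable {S A Ω : Type*} [MeasurableSpace S] [MeasurableSpace A] [mΩ : MeasurableSpace Ω]
  {d : ℕ} {ν : Measure A} {M : MDP S A} {pol : ParamPolicy S A d ν} {H T : ℕ}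
  {θ₀ : EuclideanSpace ℝ (Fin d)} {α₀ η₀ : ℝ} {μ : Measure Ω}
  {ℱ : Filtration ℕ mΩ} {θ v : ℕ → Ω → EuclideanSpace ℝ (Fin d)} {b : ℕ → Ω → ℝ}
  {τ τb : ℕ → Ω → Traj S A H} {R₀ G L : ℝ}

lemma measurable_sample (hrun : IsSharpRun M pol H T θ₀ α₀ η₀ μ ℱ θ v b τ τb) {t : ℕ}
    (ht : 1 ≤ t) (htT : t < T) : Measurable[ℱ t] fun ω => (b t ω, τ t ω, τb t ω) :=
  (hrun.measurable_unif t ht htT).prodMk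
    ((hrun.measurable_traj t htT).prodMk (hrun.measurable_trajb t ht htT))

variable [SFinite ν] [IsProbabilityMeasure μ]

/-- The joint law of the past and of the samples of iteration `t`. -/
lemma map_prodMk_sample (hrun : IsSharpRun M pol H T θ₀ α₀ η₀ μ ℱ θ v b τ τb) {t : ℕ}
    (ht : 1 ≤ t) (htT : t < T) {W : Type*} [MeasurableSpace W] {V : Ω → W}
    (hV : Measurable[ℱ (t - 1)] V)
    {q : W → EuclideanSpace ℝ (Fin d) × EuclideanSpace ℝ (Fin d)} (hq : Measurable q)
    (hqV : ∀ ω, q (V ω) = (θ t ω, θ (t - 1) ω)) :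
    μ.map (fun ω => (V ω, (b t ω, τ t ω, τb t ω))) =
      (μ.map V) ⊗ₘ ((M.sampleKernel pol H).comap q hq) := by
  have hV' : Measurable V := hV.mono (ℱ.le _) le_rfl
  have hX : Measurable fun ω => (b t ω, τ t ω, τb t ω) :=
    (hrun.measurable_sample ht htT).mono (ℱ.le _) le_rfl
  have := Measure.isProbabilityMeasure_map (μ := μ) hV'.aemeasurable
  have := Measure.isProbabilityMeasure_map (μ := μ) (hV'.prodMk hX).aemeasurable
  -- Rectangles suffice; on `s ×ˢ u` the claim is the sampling identity with `D = V ⁻¹' s` and the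
  -- indicator of `u`.
  refine Measure.ext_prod fun {s u} hs hu => ?_
  rw [Measure.compProd_apply_prod hs hu, Measure.map_apply (hV'.prodMk hX) (hs.prod hu),
    setLIntegral_map hs (Kernel.measurable_coe _ hu) hV']
  have h := hrun.sampling t ht htT (V ⁻¹' s) (hV hs) (u.indicator 1) (measurable_one.indicator hu)
  calc μ ((fun ω => (V ω, b t ω, τ t ω, τb t ω)) ⁻¹' s ×ˢ u)
      = ∫⁻ ω in V ⁻¹' s, u.indicator 1 (b t ω, τ t ω, τb t ω) ∂μ := by
        have : (fun ω => u.indicator (1 : ℝ × Traj S A H × Traj S A H → ℝ≥0∞)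
            (b t ω, τ t ω, τb t ω)) =
            ((fun ω => (b t ω, τ t ω, τb t ω)) ⁻¹' u).indicator 1 := rfl
        rw [this, lintegral_indicator_one (hX hu), Measure.restrict_apply (hX hu), Set.inter_comm]
        rfl
    _ = _ := by
        rw [h]
        refine lintegral_congr fun ω => ?_
        rw [Kernel.comap_apply, hqV, ← lintegral_indicator_one hu,
          lintegral_sampleKernel M pol _ (measurable_one.indicator hu)]

/-- Conditionally on the past, the increment of iteration `t` has the mean given by
`integral_sharpIncrement`. -/
lemma integral_inner_sharpIncrement (hrun : IsSharpRun M pol H T θ₀ α₀ η₀ μ ℱ θ v b τ τb) {t : ℕ}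
    (ht : 1 ≤ t) (htT : t < T) (hpol : pol.Regular G L) {α : ℝ}
    (hθ : Measurable[ℱ (t - 1)] (θ t)) (hθ' : Measurable[ℱ (t - 1)] (θ (t - 1)))
    {U : Ω → EuclideanSpace ℝ (Fin d)} (hU : Measurable[ℱ (t - 1)] U)
    (hInt : Integrable (fun ω => inner ℝ (U ω)
      (M.sharpIncrement pol α (θ t ω, θ (t - 1) ω) (b t ω, τ t ω, τb t ω))) μ)
    (hInt' : ∀ p, Integrable (M.sharpIncrement pol α p) (M.sampleKernel pol H p)) :
    ∫ ω, inner ℝ (U ω)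
        (M.sharpIncrement pol α (θ t ω, θ (t - 1) ω) (b t ω, τ t ω, τb t ω)) ∂μ =
      ∫ ω, inner ℝ (U ω) (∫ x, M.sharpIncrement pol α (θ t ω, θ (t - 1) ω) x
        ∂(M.sampleKernel pol H (θ t ω, θ (t - 1) ω))) ∂μ := by
  -- Carrying `U` along with the parameters turns the integrand into a function of (past, samples),
  -- to which the disintegration applies.
  set V : Ω → EuclideanSpace ℝ (Fin d) × EuclideanSpace ℝ (Fin d) × EuclideanSpace ℝ (Fin d) :=
    fun ω => (U ω, θ t ω, θ (t - 1) ω) with hVdef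
  have hV : Measurable[ℱ (t - 1)] V := hU.prodMk (hθ.prodMk hθ')
  have hV' : Measurable V := hV.mono (ℱ.le _) le_rfl
  have hX : Measurable fun ω => (b t ω, τ t ω, τb t ω) :=
    (hrun.measurable_sample ht htT).mono (ℱ.le _) le_rfl
  have hmap := hrun.map_prodMk_sample ht htT hV measurable_snd (fun ω => rfl)
  have := Measure.isProbabilityMeasure_map (μ := μ) hV'.aemeasurable
  set F : (EuclideanSpace ℝ (Fin d) × EuclideanSpace ℝ (Fin d) × EuclideanSpace ℝ (Fin d)) ×
      (ℝ × Traj S A H × Traj S A H) → ℝ :=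
    fun z => inner ℝ z.1.1 (M.sharpIncrement pol α z.1.2 z.2) with hF
  have hFm : Measurable F := by
    have hx : Measurable fun z : (EuclideanSpace ℝ (Fin d) × EuclideanSpace ℝ (Fin d) ×
        EuclideanSpace ℝ (Fin d)) × (ℝ × Traj S A H × Traj S A H) => (z.1.2, z.2) := by fun_prop
    have h := (measurable_sharpIncrement (M := M) (H := H) hpol α).comp hx
    exact measurable_fst.fst.inner h
  have hFint : Integrable F (μ.map fun ω => (V ω, (b t ω, τ t ω, τb t ω))) :=
    (integrable_map_measure hFm.aestronglyMeasurable (hV'.prodMk hX).aemeasurable).2 hInt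
  have h1 : ∫ ω, F (V ω, (b t ω, τ t ω, τb t ω)) ∂μ =
      ∫ w, ∫ x, F (w, x) ∂(M.sampleKernel pol H w.2) ∂(μ.map V) := by
    rw [← integral_map (f := F) (hV'.prodMk hX).aemeasurable hFm.aestronglyMeasurable]
    rw [hmap] at hFint ⊢
    rw [Measure.integral_compProd hFint]
    rfl
  have h2 : StronglyMeasurable fun w : EuclideanSpace ℝ (Fin d) × EuclideanSpace ℝ (Fin d) ×
      EuclideanSpace ℝ (Fin d) => ∫ x, F (w, x) ∂(M.sampleKernel pol H w.2) :=
    hFm.stronglyMeasurable.integral_kernel_prod_right'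
      (κ := (M.sampleKernel pol H).comap _ measurable_snd)
  refine h1.trans ?_
  rw [integral_map hV'.aemeasurable h2.aestronglyMeasurable]
  refine integral_congr_ae (Filter.Eventually.of_forall fun ω => ?_)
  exact integral_inner (hInt' _) _

end IsSharpRun

end

noncomputable section

/-! ### Power sums and the scalar recursion -/

/-- Bernoulli's inequality for exponents at most one gives `p (n+1)^(p-1) ≤ (n+1)^p - n^p`, which
telescopes. It serves `p = 2/3` for the errors and `p = 1/3` for the curvature. -/
lemma sum_Icc_rpow_sub_one_le {p : ℝ} (hp : 0 < p) (hp' : p ≤ 1) (n : ℕ) :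
    ∑ t ∈ Finset.Icc 1 n, (t : ℝ) ^ (p - 1) ≤ (n : ℝ) ^ p / p := by
  induction n with
  | zero => simp [Real.zero_rpow hp.ne']
  | succ n ih =>
    rw [Finset.sum_Icc_succ_top (by omega)]
    have hm : (0 : ℝ) < (n : ℝ) + 1 := by positivity
    have hB := rpow_one_add_le_one_add_mul_self (s := -((n : ℝ) + 1)⁻¹)
      (neg_le_neg (inv_le_one_of_one_le₀ (by linarith [n.cast_nonneg (α := ℝ)]))) hp.le hp'
    have hn : (n : ℝ) = (n + 1) * (1 + -((n : ℝ) + 1)⁻¹) := by field_simp; ring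
    have h1 : (n : ℝ) ^ p ≤ (n + 1 : ℝ) ^ p - p * (n + 1 : ℝ) ^ (p - 1) := by
      calc (n : ℝ) ^ p = (n + 1 : ℝ) ^ p * (1 + -((n : ℝ) + 1)⁻¹) ^ p := by
            conv_lhs => rw [hn]
            refine Real.mul_rpow hm.le ?_
            linarith [inv_le_one_of_one_le₀ (a := (n : ℝ) + 1) (by linarith [n.cast_nonneg (α := ℝ)])]
        _ ≤ (n + 1 : ℝ) ^ p * (1 + p * -((n : ℝ) + 1)⁻¹) := by gcongr
        _ = _ := by rw [Real.rpow_sub_one hm.ne']; ring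
    push_cast
    calc _ ≤ (n : ℝ) ^ p / p + (n + 1 : ℝ) ^ (p - 1) := by gcongr
      _ ≤ ((n + 1 : ℝ) ^ p - p * (n + 1 : ℝ) ^ (p - 1)) / p + (n + 1 : ℝ) ^ (p - 1) := by gcongr
      _ = _ := by field_simp; ring

/-- Bernoulli again. For `p = 2/3` this increment is the origin of the threshold `α₀ > 2/3`. -/
lemma add_one_rpow_le {p s : ℝ} (hp : 0 ≤ p) (hp' : p ≤ 1) (hs : 1 ≤ s) :
    (s + 1) ^ p ≤ s ^ p + p := by
  have hs0 : 0 < s := by linarith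
  have hB := rpow_one_add_le_one_add_mul_self (s := s⁻¹)
    ((by norm_num : (-1 : ℝ) ≤ 0).trans (inv_nonneg.2 hs0.le)) hp hp'
  calc (s + 1) ^ p = s ^ p * (1 + s⁻¹) ^ p := by
        rw [← Real.mul_rpow hs0.le (by positivity), mul_add, mul_inv_cancel₀ hs0.ne', mul_one]
    _ ≤ s ^ p * (1 + p * s⁻¹) := by gcongr
    _ = s ^ p + p * s ^ (p - 1) := by rw [Real.rpow_sub_one hs0.ne']; ring
    _ ≤ s ^ p + p := by
        gcongr
        exact mul_le_of_le_one_right hp (Real.rpow_le_one_of_one_le_of_nonpos hs (by linarith))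

/-- Abel summation against a nonnegative monotone weight. -/
lemma sum_Icc_mul_sub_le {w f : ℕ → ℝ} {c : ℝ} (hw : Monotone w) (hw0 : ∀ t, 0 ≤ w t)
    (hf : ∀ t, |f t| ≤ c) (n : ℕ) :
    ∑ t ∈ Finset.Icc 1 n, w t * (f (t + 1) - f t) ≤ 2 * c * w n := by
  -- Keeping the boundary term makes the induction close: the step amounts to `(w (n+1) - w n) (f
  -- (n+1) + c) ≥ 0`.
  have key : ∑ t ∈ Finset.Icc 1 n, w t * (f (t + 1) - f t) ≤ w n * f (n + 1) + c * w n := by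
    induction n with
    | zero =>
      have := mul_nonneg (hw0 0) (by linarith [(abs_le.1 (hf 1)).1] : 0 ≤ f 1 + c)
      simp only [Finset.Icc_eq_empty_of_lt zero_lt_one, Finset.sum_empty, zero_add]
      linarith
    | succ n ih =>
      rw [Finset.sum_Icc_succ_top (by omega)]
      have := mul_nonneg (sub_nonneg.2 (hw n.le_succ))
        (by linarith [(abs_le.1 (hf (n + 1))).1] : 0 ≤ f (n + 1) + c)
      rw [Nat.succ_eq_add_one] at this
      linarith
  nlinarith [mul_le_mul_of_nonneg_left (abs_le.1 (hf (n + 1))).2 (hw0 n)]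

lemma sharpEta_nonneg {η₀ : ℝ} (h : 0 ≤ η₀) (t : ℕ) : 0 ≤ sharpEta η₀ t := by
  unfold sharpEta
  split_ifs
  · exact h
  · positivity

lemma sharpAlpha_nonneg {α₀ : ℝ} (h : 0 ≤ α₀) (t : ℕ) : 0 ≤ sharpAlpha α₀ t := by
  unfold sharpAlpha; positivity

lemma sharpAlpha_le_one {α₀ : ℝ} (h : α₀ ≤ 1) {t : ℕ} (ht : 1 ≤ t) : sharpAlpha α₀ t ≤ 1 := by
  have : (1 : ℝ) ≤ (t : ℝ) ^ ((2 : ℝ) / 3) :=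
    Real.one_le_rpow (by exact_mod_cast ht) (by norm_num)
  unfold sharpAlpha
  rw [div_le_one (by linarith)]
  linarith

/-- The denominator of `C` is the margin `α₀ - 2/3`; what remains must dominate the noise in the
recursion. -/
lemma sharpC_mul {α₀ η₀ σg σB : ℝ} (hα₀ : 2 / 3 < α₀) :
    sharpC α₀ η₀ σg σB * (α₀ - 2 / 3) =
      48 * σB ^ 2 * η₀ ^ 2 + (6 * α₀ ^ 2 + 1) * σg ^ 2 := by
  have h1 : 3 * α₀ - 2 ≠ 0 := by linarith
  have h2 : α₀ ≠ 0 := by linarith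
  unfold sharpC
  field_simp

/-- The margin is at most one. This form covers the base case of the recursion and gives `σ_g ≤ √C`
for the last iterate. -/
lemma le_sharpC {α₀ η₀ σg σB : ℝ} (hα₀ : 2 / 3 < α₀) (hα₀' : α₀ ≤ 1) :
    48 * σB ^ 2 * η₀ ^ 2 + (6 * α₀ ^ 2 + 1) * σg ^ 2 ≤ sharpC α₀ η₀ σg σB := by
  rw [← sharpC_mul hα₀]
  have h0 : 0 ≤ sharpC α₀ η₀ σg σB := by
    by_contra! h
    have := mul_neg_of_neg_of_pos h (sub_pos.2 hα₀)
    rw [sharpC_mul hα₀] at this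
    nlinarith [mul_nonneg (sq_nonneg σB) (sq_nonneg η₀), sq_nonneg σg, sq_nonneg (α₀ * σg)]
  exact mul_le_of_le_one_right h0 (by linarith)

/-- The recursion satisfied by the mean squared error of the momentum vectors forces the rate
`t^{-2/3}`. -/
lemma le_sharpC_div_of_recursion {a : ℕ → ℝ} {α₀ η₀ σg σB : ℝ} {T : ℕ} (hα₀ : 2 / 3 < α₀)
    (hα₀' : α₀ ≤ 1) (ha : ∀ t, 0 ≤ a t) (h0 : a 0 ≤ 4 * σg ^ 2)
    (hstep : ∀ t, 1 ≤ t → t < T → a t ≤ (1 - sharpAlpha α₀ t) ^ 2 * a (t - 1) +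
      (4 * ((1 - sharpAlpha α₀ t) * (σB * sharpEta η₀ (t - 1))) ^ 2
        + 2 * (sharpAlpha α₀ t * σg) ^ 2))
    (t : ℕ) (ht : 1 ≤ t) (htT : t < T) :
    a t ≤ sharpC α₀ η₀ σg σB / (t : ℝ) ^ ((2 : ℝ) / 3) := by
  have hB : 0 ≤ σB ^ 2 * η₀ ^ 2 := by positivity
  have hg : 0 ≤ σg ^ 2 := by positivity
  have hg' : 0 ≤ α₀ ^ 2 * σg ^ 2 := by positivity
  have hCmul := sharpC_mul (η₀ := η₀) (σg := σg) (σB := σB) hα₀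
  have hC := le_sharpC (η₀ := η₀) (σg := σg) (σB := σB) hα₀ hα₀'
  set C := sharpC α₀ η₀ σg σB
  have hC0 : 0 ≤ C := le_trans (by nlinarith) hC
  induction t, ht using Nat.le_induction with
  | base =>
    have h := hstep 1 le_rfl htT
    simp only [sharpAlpha, sharpEta, Nat.cast_one, Real.one_rpow, div_one, Nat.sub_self,
      if_true] at h ⊢
    -- Since `α_1 = α₀ > 2/3`, the initial error is already contracted by a factor below `1/3`.
    have h1 : (1 - α₀) ^ 2 ≤ 1 / 9 := by nlinarith
    have h2 : (1 - α₀) ^ 2 * a 0 ≤ 1 / 9 * (4 * σg ^ 2) := mul_le_mul h1 h0 (ha 0) (by norm_num)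
    have h3 : ((1 - α₀) * (σB * η₀)) ^ 2 ≤ 1 / 9 * (σB ^ 2 * η₀ ^ 2) := by
      rw [mul_pow, mul_pow]
      exact mul_le_mul_of_nonneg_right h1 hB
    nlinarith
  | succ t ht ih =>
    have ih := ih (by omega)
    have h := hstep (t + 1) (by omega) htT
    have hα0 := sharpAlpha_nonneg (α₀ := α₀) (by linarith) (t + 1)
    have hα1 := sharpAlpha_le_one hα₀' (t := t + 1) (by omega)
    have ht1 : (1 : ℝ) ≤ t := by exact_mod_cast ht
    rw [Nat.add_sub_cancel] at h
    have hx : ((t : ℝ) + 1) ^ ((2 : ℝ) / 3) ≤ (t : ℝ) ^ ((2 : ℝ) / 3) + 2 / 3 :=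
      add_one_rpow_le (by norm_num) (by norm_num) ht1
    have hy : 1 ≤ (t : ℝ) ^ ((2 : ℝ) / 3) := Real.one_le_rpow ht1 (by norm_num)
    have hyx : (t : ℝ) ^ ((2 : ℝ) / 3) ≤ ((t : ℝ) + 1) ^ ((2 : ℝ) / 3) :=
      Real.rpow_le_rpow (by linarith) (by linarith) (by norm_num)
    have hαx : sharpAlpha α₀ (t + 1) = α₀ / ((t : ℝ) + 1) ^ ((2 : ℝ) / 3) := by
      simp [sharpAlpha]
    have hηy : sharpEta η₀ t = η₀ / (t : ℝ) ^ ((2 : ℝ) / 3) := by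
      exact if_neg (by omega)
    push_cast
    set x := ((t : ℝ) + 1) ^ ((2 : ℝ) / 3)
    set y := (t : ℝ) ^ ((2 : ℝ) / 3)
    set α := sharpAlpha α₀ (t + 1)
    have hx0 : 0 < x := by linarith
    have hy0 : 0 < y := by linarith
    -- One factor `1 - α` of the contraction is enough and the other is dropped.
    have b1 : (1 - α) ^ 2 * a t ≤ (1 - α) * (C / y) :=
      mul_le_mul (by nlinarith) ih (ha t) (by linarith)
    have b2 : ((1 - α) * (σB * sharpEta η₀ t)) ^ 2 ≤ 4 * (σB ^ 2 * η₀ ^ 2) / x ^ 2 := by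
      have e1 : ((1 - α) * (σB * sharpEta η₀ t)) ^ 2 ≤ (σB * sharpEta η₀ t) ^ 2 := by
        rw [mul_pow]
        exact mul_le_of_le_one_left (sq_nonneg _) (by nlinarith)
      refine e1.trans ?_
      rw [hηy, ← mul_div_assoc, div_pow, mul_pow, div_le_div_iff₀ (by positivity) (by positivity)]
      -- `x ≤ y + 2/3 ≤ 2y`: the price of the step size having index `t` rather than `t + 1`.
      have : x ^ 2 ≤ 4 * y ^ 2 := by nlinarith
      nlinarith [mul_le_mul_of_nonneg_left this hB]
    have b3 : (α * σg) ^ 2 = α₀ ^ 2 * σg ^ 2 / x ^ 2 := by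
      rw [hαx]; ring
    have b4 : a (t + 1) ≤ (1 - α) * (C / y) +
        (16 * (σB ^ 2 * η₀ ^ 2) + 2 * (α₀ ^ 2 * σg ^ 2)) / x ^ 2 := by
      refine h.trans ((add_le_add b1 (add_le_add (mul_le_mul_of_nonneg_left b2 zero_le_four)
        (by rw [b3]))).trans (le_of_eq ?_))
      ring
    refine b4.trans ?_
    have b5 : (16 * (σB ^ 2 * η₀ ^ 2) + 2 * (α₀ ^ 2 * σg ^ 2)) / x ^ 2 ≤
        C * (α₀ - 2 / 3) / (x * y) := by
      have hD : 16 * (σB ^ 2 * η₀ ^ 2) + 2 * (α₀ ^ 2 * σg ^ 2) ≤ C * (α₀ - 2 / 3) := by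
        rw [hCmul]; linarith
      have hxy : x * y ≤ x ^ 2 := by
        rw [pow_two]; exact mul_le_mul_of_nonneg_left hyx hx0.le
      exact div_le_div₀ (mul_nonneg hC0 (by linarith)) hD (mul_pos hx0 hy0) hxy
    -- As `α = α₀ / x`, the `α₀` of the contraction cancels that of the noise, leaving `x - 2/3 ≤
    -- y`.
    have b6 : (1 - α) * (C / y) + C * (α₀ - 2 / 3) / (x * y) = C * (x - 2 / 3) / (x * y) := by
      rw [hαx]; field_simp; ring
    calc _ ≤ C * (x - 2 / 3) / (x * y) := by rw [← b6]; gcongr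
      _ ≤ C * y / (x * y) := by gcongr; linarith
      _ = C / x := by field_simp

end

noncomputable section

namespace MDP

variable {S A : Type*} [MeasurableSpace S] [MeasurableSpace A] {M : MDP S A}
  {d H : ℕ} {ν : Measure A} {pol : ParamPolicy S A d ν} {R₀ G L : ℝ}

/-! ### Smoothness of the expected return -/

lemma continuous_gradient_J [SFinite ν] (hR₀ : 0 ≤ R₀) (hG : 0 ≤ G) (hL : 0 ≤ L)
    (hr : M.BoundedReward R₀) (hpol : pol.Regular G L) : Continuous (gradient (M.J pol H)) :=
  continuous_iff_continuousAt.2 fun θ =>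
    (hasFDerivAt_gradient_J hR₀ hG hL hr hpol θ).continuousAt

/-- Mean value inequality for `J` minus its linearisation, on the ball about `θ` through `θ'`. The
constant `K` in place of `K/2` is all that is needed. -/
lemma inner_gradient_J_sub_le [SFinite ν] (hR₀ : 0 ≤ R₀) (hG : 0 ≤ G) (hL : 0 ≤ L)
    (hr : M.BoundedReward R₀) (hpol : pol.Regular G L) (θ θ' : EuclideanSpace ℝ (Fin d)) :
    inner ℝ (gradient (M.J pol H) θ) (θ' - θ) ≤ M.J pol H θ' - M.J pol H θ +
      (H * G ^ 2 + L) * (R₀ / (1 - M.γ) ^ 2) * ‖θ' - θ‖ ^ 2 := by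
  set K := (H * G ^ 2 + L) * (R₀ / (1 - M.γ) ^ 2)
  have hK : 0 ≤ K := by positivity
  have h := (convex_closedBall θ ‖θ' - θ‖).norm_image_sub_le_of_norm_hasFDerivWithin_le'
    (f := M.J pol H) (x := θ) (y := θ') (C := K * ‖θ' - θ‖)
    (φ := InnerProductSpace.toDual ℝ _ (gradient (M.J pol H) θ))
    (fun x _ => (hasGradientAt_J hR₀ hG hr hpol
      x).differentiableAt.hasGradientAt.hasFDerivAt.hasFDerivWithinAt)
    (fun x hx => by
      rw [← map_sub, LinearIsometryEquiv.norm_map]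
      refine (norm_gradient_J_sub_le hR₀ hG hL hr hpol θ x).trans ?_
      exact mul_le_mul_of_nonneg_left (mem_closedBall_iff_norm.1 hx) hK)
    (Metric.mem_closedBall_self (norm_nonneg _)) (by simp [dist_eq_norm])
  rw [InnerProductSpace.toDual_apply_apply, Real.norm_eq_abs] at h
  nlinarith [(abs_le.1 h).1]

/-! ### The constants `σ_g` and `σ_B` -/

lemma sigmaG_eq (hR₀ : 0 ≤ R₀) (hG : 0 ≤ G) : M.sigmaG R₀ G = G * (R₀ / (1 - M.γ) ^ 2) := by
  rw [sigmaG, show G ^ 2 * R₀ ^ 2 / (1 - M.γ) ^ 4 = (G * (R₀ / (1 - M.γ) ^ 2)) ^ 2 by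
    rw [mul_pow, div_pow, ← pow_mul]; ring]
  exact Real.sqrt_sq (by positivity)

/-- `(a + b)² ≤ 2(a² + b²)`: the bound on `B` adds its two parts, while `σ_B²` adds their squares.
-/
lemma sq_le_two_mul_sigmaB_sq :
    ((H * G ^ 2 + L) * (R₀ / (1 - M.γ) ^ 2)) ^ 2 ≤ 2 * M.sigmaB H R₀ G L ^ 2 := by
  rw [sigmaB, Real.sq_sqrt (by positivity)]
  have h : (H * G ^ 2 + L) ^ 2 ≤ 2 * ((H : ℝ) ^ 2 * G ^ 4 + L ^ 2) := by
    nlinarith [sq_nonneg (H * G ^ 2 - L)]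
  calc _ = (H * G ^ 2 + L) ^ 2 * (R₀ / (1 - M.γ) ^ 2) ^ 2 := mul_pow _ _ _
    _ ≤ 2 * ((H : ℝ) ^ 2 * G ^ 4 + L ^ 2) * (R₀ / (1 - M.γ) ^ 2) ^ 2 := by gcongr
    _ = _ := by rw [div_pow, ← pow_mul]; ring

lemma le_two_mul_sigmaB : (H * G ^ 2 + L) * (R₀ / (1 - M.γ) ^ 2) ≤ 2 * M.sigmaB H R₀ G L := by
  have h0 : 0 ≤ M.sigmaB H R₀ G L := Real.sqrt_nonneg _
  refine abs_le_of_sq_le_sq' (?_ : _ ≤ (2 * M.sigmaB H R₀ G L) ^ 2) (by positivity) |>.2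
  nlinarith [sq_le_two_mul_sigmaB_sq (M := M) (H := H) (R₀ := R₀) (G := G) (L := L)]

end MDP

/-! ### A second moment inequality -/

/-- With `U = c e - m`, subtracting `‖c e‖² = ‖U + m‖²` from `‖U + Z‖²` leaves `2⟨U, Z - m⟩ + ‖Z‖² -
‖m‖²`. The cross term integrates to zero and `-‖m‖²` is discarded, so the noise costs only a bound
on `Z`. -/
lemma integral_norm_sq_add_le_of_integral_inner_eq {Ω E : Type*} [MeasurableSpace Ω]
    {μ : Measure Ω} [IsProbabilityMeasure μ] [NormedAddCommGroup E] [InnerProductSpace ℝ E]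
    [MeasurableSpace E] [BorelSpace E] [SecondCountableTopology E] {e m Z : Ω → E} {B B' D : ℝ}
    (c : ℝ) (he : Measurable e) (hm : Measurable m) (hZ : Measurable Z) (hB : ∀ ω, ‖e ω‖ ≤ B)
    (hB' : ∀ ω, ‖m ω‖ ≤ B') (hD : ∀ ω, ‖Z ω‖ ≤ D)
    (hcross : Integrable (fun ω => inner ℝ (c • e ω - m ω) (Z ω)) μ →
      ∫ ω, inner ℝ (c • e ω - m ω) (Z ω) ∂μ = ∫ ω, inner ℝ (c • e ω - m ω) (m ω) ∂μ) :
    ∫ ω, ‖(c • e ω - m ω) + Z ω‖ ^ 2 ∂μ ≤ c ^ 2 * ∫ ω, ‖e ω‖ ^ 2 ∂μ + D ^ 2 := by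
  have bdd : ∀ {f g : Ω → E} {a a' : ℝ}, Measurable f → Measurable g →
      (∀ ω, ‖f ω‖ ≤ a) → (∀ ω, ‖g ω‖ ≤ a') → Integrable (fun ω => inner ℝ (f ω) (g ω)) μ :=
    fun {f g a a'} hf hg ha ha' => Integrable.of_bound (hf.inner hg).aestronglyMeasurable (a * a')
      (Filter.Eventually.of_forall fun ω => (norm_inner_le_norm _ _).trans
        (mul_le_mul (ha ω) (ha' ω) (norm_nonneg _) ((norm_nonneg _).trans (ha ω))))
  have hU : Measurable fun ω => c • e ω - m ω := (he.const_smul c).sub hm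
  have hUb : ∀ ω, ‖c • e ω - m ω‖ ≤ ‖c‖ * B + B' := fun ω => norm_sub_le_of_le
    ((norm_smul_le _ _).trans (mul_le_mul_of_nonneg_left (hB ω) (norm_nonneg c))) (hB' ω)
  have hUZ := bdd hU hZ hUb hD
  have hUm := bdd hU hm hUb hB'
  have hee : Integrable (fun ω => ‖e ω‖ ^ 2) μ := by
    simpa only [real_inner_self_eq_norm_sq] using bdd he he hB hB
  have hdecomp : ∀ ω, ‖(c • e ω - m ω) + Z ω‖ ^ 2 ≤ c ^ 2 * ‖e ω‖ ^ 2 +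
      (2 * (inner ℝ (c • e ω - m ω) (Z ω) - inner ℝ (c • e ω - m ω) (m ω)) + D ^ 2) := fun ω => by
    have h2 : ‖c • e ω‖ ^ 2 = ‖(c • e ω - m ω) + m ω‖ ^ 2 := by rw [sub_add_cancel]
    rw [norm_add_sq_real, norm_smul, mul_pow, Real.norm_eq_abs, sq_abs] at h2
    rw [norm_add_sq_real]
    have h3 : ‖Z ω‖ ^ 2 ≤ D ^ 2 := pow_le_pow_left₀ (norm_nonneg _) (hD ω) 2
    linarith [sq_nonneg ‖m ω‖]
  have hcr : Integrable (fun ω => 2 * (inner ℝ (c • e ω - m ω) (Z ω) -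
      inner ℝ (c • e ω - m ω) (m ω))) μ := (hUZ.sub hUm).const_mul 2
  have hR : Integrable (fun ω => 2 * (inner ℝ (c • e ω - m ω) (Z ω) -
      inner ℝ (c • e ω - m ω) (m ω)) + D ^ 2) μ := hcr.add (integrable_const _)
  calc _ ≤ ∫ ω, (c ^ 2 * ‖e ω‖ ^ 2 + (2 * (inner ℝ (c • e ω - m ω) (Z ω) -
        inner ℝ (c • e ω - m ω) (m ω)) + D ^ 2)) ∂μ :=
        integral_mono_of_nonneg (Filter.Eventually.of_forall fun _ => sq_nonneg _)
          ((hee.const_mul _).add hR) (Filter.Eventually.of_forall hdecomp)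
    _ = _ := by
        rw [integral_add (hee.const_mul _) hR, integral_const_mul,
          integral_add hcr (integrable_const _), integral_const_mul, integral_sub hUZ hUm,
          hcross hUZ]
        simp

namespace IsSharpRun

open MDP

variable {S A Ω : Type*} [MeasurableSpace S] [MeasurableSpace A] [mΩ : MeasurableSpace Ω]
  {d : ℕ} {ν : Measure A} {M : MDP S A} {pol : ParamPolicy S A d ν} {H T : ℕ}
  {θ₀ : EuclideanSpace ℝ (Fin d)} {α₀ η₀ : ℝ} {μ : Measure Ω}
  {ℱ : Filtration ℕ mΩ} {θ v : ℕ → Ω → EuclideanSpace ℝ (Fin d)} {b : ℕ → Ω → ℝ}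
  {τ τb : ℕ → Ω → Traj S A H} {R₀ G L : ℝ}

/-! ### Regularity of the iterates -/

lemma v_eq (hrun : IsSharpRun M pol H T θ₀ α₀ η₀ μ ℱ θ v b τ τb) {t : ℕ} (ht : 1 ≤ t)
    (htT : t < T) (ω : Ω) : v t ω = (1 - sharpAlpha α₀ t) • v (t - 1) ω +
      M.sharpIncrement pol (sharpAlpha α₀ t) (θ t ω, θ (t - 1) ω) (b t ω, τ t ω, τb t ω) := by
  rw [hrun.v_step t ht htT ω, sharpIncrement, smul_add, add_assoc]

lemma norm_theta_succ_sub_le (hrun : IsSharpRun M pol H T θ₀ α₀ η₀ μ ℱ θ v b τ τb) (hη₀ : 0 ≤ η₀)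
    {t : ℕ} (htT : t < T) (ω : Ω) : ‖θ (t + 1) ω - θ t ω‖ ≤ sharpEta η₀ t := by
  rw [hrun.theta_step t htT ω, add_sub_cancel_left, norm_smul, norm_smul, norm_inv, norm_norm,
    Real.norm_of_nonneg (sharpEta_nonneg hη₀ t)]
  exact mul_le_of_le_one_right (sharpEta_nonneg hη₀ t) inv_mul_le_one

lemma measurable_theta_succ_of_measurable (hrun : IsSharpRun M pol H T θ₀ α₀ η₀ μ ℱ θ v b τ τb)
    {t : ℕ} (htT : t < T) (hθ : Measurable[ℱ t] (θ t)) (hv : Measurable[ℱ t] (v t)) :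
    Measurable[ℱ t] (θ (t + 1)) := by
  have h : θ (t + 1) = fun ω => θ t ω + sharpEta η₀ t • (‖v t ω‖⁻¹ • v t ω) :=
    funext fun ω => hrun.theta_step t htT ω
  rw [h]
  have hF : Measurable fun x : EuclideanSpace ℝ (Fin d) × EuclideanSpace ℝ (Fin d) =>
      x.1 + sharpEta η₀ t • (‖x.2‖⁻¹ • x.2) := by fun_prop
  exact hF.comp (hθ.prodMk hv)

lemma measurable_theta_v (hrun : IsSharpRun M pol H T θ₀ α₀ η₀ μ ℱ θ v b τ τb)
    (hpol : pol.Regular G L) (t : ℕ) (htT : t < T) :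
    Measurable[ℱ t] (θ t) ∧ Measurable[ℱ t] (v t) := by
  induction t with
  | zero =>
    have h0 : θ 0 = fun _ => θ₀ := funext hrun.theta_zero
    have hv0 : v 0 = fun ω => M.gradEst pol (τ 0 ω) θ₀ := by
      funext ω
      rw [hrun.v_zero ω, hrun.theta_zero ω]
    rw [h0, hv0]
    exact ⟨measurable_const,
      (M.measurable_gradEst_right hpol θ₀).comp (hrun.measurable_traj 0 htT)⟩
  | succ t ih =>
    obtain ⟨hθ, hv⟩ := ih (by omega)
    have hle : ℱ t ≤ ℱ (t + 1) := ℱ.mono t.le_succ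
    have hθ' : Measurable[ℱ (t + 1)] (θ (t + 1)) :=
      (hrun.measurable_theta_succ_of_measurable (by omega) hθ hv).mono hle le_rfl
    refine ⟨hθ', ?_⟩
    have h : v (t + 1) = fun ω => (1 - sharpAlpha α₀ (t + 1)) • v t ω +
        M.sharpIncrement pol (sharpAlpha α₀ (t + 1)) (θ (t + 1) ω, θ t ω)
          (b (t + 1) ω, τ (t + 1) ω, τb (t + 1) ω) :=
      funext fun ω => hrun.v_eq (by omega) htT ω
    rw [h]
    have hx := (hθ'.prodMk (hθ.mono hle le_rfl)).prodMk
      (hrun.measurable_sample (t := t + 1) (by omega) htT)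
    have hZ := (M.measurable_sharpIncrement (H := H) hpol (sharpAlpha α₀ (t + 1))).comp hx
    have hF : Measurable fun x : EuclideanSpace ℝ (Fin d) × EuclideanSpace ℝ (Fin d) =>
        (1 - sharpAlpha α₀ (t + 1)) • x.1 + x.2 := by fun_prop
    exact hF.comp ((hv.mono hle le_rfl).prodMk hZ)

lemma measurable_theta_succ (hrun : IsSharpRun M pol H T θ₀ α₀ η₀ μ ℱ θ v b τ τb)
    (hpol : pol.Regular G L) {t : ℕ} (htT : t < T) : Measurable[ℱ t] (θ (t + 1)) :=
  hrun.measurable_theta_succ_of_measurable htT (hrun.measurable_theta_v hpol t htT).1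
    (hrun.measurable_theta_v hpol t htT).2

lemma norm_sharpIncrement_sample_le (hrun : IsSharpRun M pol H T θ₀ α₀ η₀ μ ℱ θ v b τ τb)
    (hR₀ : 0 ≤ R₀) (hG : 0 ≤ G) (hL : 0 ≤ L) (hr : M.BoundedReward R₀) (hpol : pol.Regular G L)
    (hα₀ : 0 ≤ α₀) (hα₀' : α₀ ≤ 1) (hη₀ : 0 ≤ η₀) {t : ℕ} (ht : 1 ≤ t) (htT : t < T) (ω : Ω) :
    ‖M.sharpIncrement pol (sharpAlpha α₀ t) (θ t ω, θ (t - 1) ω) (b t ω, τ t ω, τb t ω)‖ ≤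
      (1 - sharpAlpha α₀ t) * ((H * G ^ 2 + L) * (R₀ / (1 - M.γ) ^ 2) * sharpEta η₀ (t - 1)) +
        sharpAlpha α₀ t * (G * (R₀ / (1 - M.γ) ^ 2)) := by
  have hα1 := sharpAlpha_le_one hα₀' ht
  refine (norm_sharpIncrement_le hR₀ hG hL hr hpol (sharpAlpha_nonneg hα₀ t) hα1 _ _).trans ?_
  have h := hrun.norm_theta_succ_sub_le hη₀ (t := t - 1) (by omega) ω
  rw [Nat.sub_add_cancel ht] at h
  gcongr

/-- Only the existence of a deterministic bound matters; it secures integrability. -/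
lemma exists_norm_v_le (hrun : IsSharpRun M pol H T θ₀ α₀ η₀ μ ℱ θ v b τ τb)
    (hR₀ : 0 ≤ R₀) (hG : 0 ≤ G) (hL : 0 ≤ L) (hr : M.BoundedReward R₀) (hpol : pol.Regular G L)
    (hα₀ : 0 ≤ α₀) (hα₀' : α₀ ≤ 1) (hη₀ : 0 ≤ η₀) (t : ℕ) (htT : t < T) :
    ∃ B, ∀ ω, ‖v t ω‖ ≤ B := by
  induction t with
  | zero => exact ⟨_, fun ω => by rw [hrun.v_zero]; exact norm_gradEst_le hR₀ hG hr hpol _ _⟩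
  | succ t ih =>
    obtain ⟨B, hB⟩ := ih (by omega)
    have h1 : ∀ ω, ‖(1 - sharpAlpha α₀ (t + 1)) • v t ω‖ ≤ ‖1 - sharpAlpha α₀ (t + 1)‖ * B :=
      fun ω => (norm_smul_le _ _).trans (mul_le_mul_of_nonneg_left (hB ω) (norm_nonneg _))
    have h2 := fun ω => hrun.norm_sharpIncrement_sample_le hR₀ hG hL hr hpol hα₀ hα₀' hη₀
      (t := t + 1) (by omega) htT ω
    exact ⟨_, fun ω => (congrArg norm (hrun.v_eq (by omega) htT ω)).trans_le
      (norm_add_le_of_le (h1 ω) (h2 ω))⟩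

/-! ### Pathwise ascent -/

variable [SFinite ν]

/-- With `u = v/‖v‖` and `e = v - ∇J`, one has `⟨∇J, u⟩ = ‖v‖ - ⟨e, u⟩ ≥ ‖∇J‖ - 2‖e‖`. Insert this
into the smoothness inequality and divide by `η_t`. -/
lemma norm_gradient_J_theta_le (hrun : IsSharpRun M pol H T θ₀ α₀ η₀ μ ℱ θ v b τ τb)
    (hR₀ : 0 ≤ R₀) (hG : 0 ≤ G) (hL : 0 ≤ L) (hr : M.BoundedReward R₀) (hpol : pol.Regular G L)
    (hη₀ : 0 < η₀) {t : ℕ} (ht : 1 ≤ t) (htT : t < T) (ω : Ω) :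
    ‖gradient (M.J pol H) (θ t ω)‖ ≤
      (t : ℝ) ^ ((2 : ℝ) / 3) * (M.J pol H (θ (t + 1) ω) - M.J pol H (θ t ω)) / η₀ +
      2 * ‖v t ω - gradient (M.J pol H) (θ t ω)‖ +
      (H * G ^ 2 + L) * (R₀ / (1 - M.γ) ^ 2) * η₀ * (t : ℝ) ^ ((1 : ℝ) / 3 - 1) := by
  have hD := inner_gradient_J_sub_le (H := H) hR₀ hG hL hr hpol (θ t ω) (θ (t + 1) ω)
  have hn := hrun.norm_theta_succ_sub_le hη₀.le htT ω
  have hs := hrun.theta_step t htT ω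
  have ht0 : (0 : ℝ) < t := by exact_mod_cast ht
  set w := (t : ℝ) ^ ((2 : ℝ) / 3) with hw
  have hw0 : 0 < w := Real.rpow_pos_of_pos ht0 _
  have hwinv : (t : ℝ) ^ ((1 : ℝ) / 3 - 1) = w⁻¹ := by
    rw [hw, ← Real.rpow_neg ht0.le]; norm_num
  have hη : sharpEta η₀ t = η₀ / w := if_neg (by omega)
  rw [hwinv]
  set K := (H * G ^ 2 + L) * (R₀ / (1 - M.γ) ^ 2)
  have hK : 0 ≤ K := by positivity
  set g := gradient (M.J pol H) (θ t ω)
  set e := v t ω - g with he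
  have hu : ‖‖v t ω‖⁻¹ • v t ω‖ ≤ 1 := by
    rw [norm_smul, norm_inv, norm_norm]
    exact inv_mul_le_one
  have hvu : inner ℝ (v t ω) (‖v t ω‖⁻¹ • v t ω) = ‖v t ω‖ := by
    rw [real_inner_smul_right, real_inner_self_eq_norm_sq]
    -- For `v = 0` the convention `v/‖v‖ = 0` keeps the identity true, so no iterate is exceptional.
    by_cases h : ‖v t ω‖ = 0
    · simp [h]
    · field_simp
  have hgu : ‖g‖ - 2 * ‖e‖ ≤ inner ℝ g (‖v t ω‖⁻¹ • v t ω) := by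
    have h1 : inner ℝ g (‖v t ω‖⁻¹ • v t ω) = ‖v t ω‖ - inner ℝ e (‖v t ω‖⁻¹ • v t ω) := by
      rw [he, inner_sub_left, hvu]; ring
    have h2 : inner ℝ e (‖v t ω‖⁻¹ • v t ω) ≤ ‖e‖ :=
      (real_inner_le_norm _ _).trans (mul_le_of_le_one_right (norm_nonneg _) hu)
    have h3 : ‖g‖ ≤ ‖v t ω‖ + ‖e‖ := by
      have : g = v t ω - e := by rw [he]; abel
      rw [this]; exact norm_sub_le _ _
    linarith
  have hstep : θ (t + 1) ω - θ t ω = sharpEta η₀ t • (‖v t ω‖⁻¹ • v t ω) := by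
    rw [hs, add_sub_cancel_left]
  have hsq : K * ‖θ (t + 1) ω - θ t ω‖ ^ 2 ≤ K * sharpEta η₀ t ^ 2 :=
    mul_le_mul_of_nonneg_left (pow_le_pow_left₀ (norm_nonneg _) hn 2) hK
  have hin : inner ℝ g (θ (t + 1) ω - θ t ω) =
      sharpEta η₀ t * inner ℝ g (‖v t ω‖⁻¹ • v t ω) := by
    rw [hstep, real_inner_smul_right]
  rw [hin] at hD
  have hfin : η₀ / w * (‖g‖ - 2 * ‖e‖) ≤
      M.J pol H (θ (t + 1) ω) - M.J pol H (θ t ω) + K * (η₀ / w) ^ 2 := by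
    rw [hη] at hD hsq
    have := mul_le_mul_of_nonneg_left hgu (div_pos hη₀ hw0).le
    linarith
  have hc : 0 ≤ w / η₀ := (div_pos hw0 hη₀).le
  have := mul_le_mul_of_nonneg_left hfin hc
  have e1 : w / η₀ * (η₀ / w * (‖g‖ - 2 * ‖e‖)) = ‖g‖ - 2 * ‖e‖ := by field_simp
  have e2 : w / η₀ * (M.J pol H (θ (t + 1) ω) - M.J pol H (θ t ω) + K * (η₀ / w) ^ 2) =
      w * (M.J pol H (θ (t + 1) ω) - M.J pol H (θ t ω)) / η₀ + K * η₀ * w⁻¹ := by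
    field_simp
  linarith

lemma sum_norm_gradient_J_le (hrun : IsSharpRun M pol H T θ₀ α₀ η₀ μ ℱ θ v b τ τb)
    (hR₀ : 0 ≤ R₀) (hG : 0 ≤ G) (hL : 0 ≤ L) (hr : M.BoundedReward R₀) (hpol : pol.Regular G L)
    (hη₀ : 0 < η₀) {n : ℕ} (hn : n < T) (ω : Ω) :
    ∑ t ∈ Finset.Icc 1 n, ‖gradient (M.J pol H) (θ t ω)‖ ≤
      2 * (R₀ / (1 - M.γ)) * (n : ℝ) ^ ((2 : ℝ) / 3) / η₀ +
      2 * ∑ t ∈ Finset.Icc 1 n, ‖v t ω - gradient (M.J pol H) (θ t ω)‖ +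
      3 * ((H * G ^ 2 + L) * (R₀ / (1 - M.γ) ^ 2)) * η₀ * (n : ℝ) ^ ((1 : ℝ) / 3) := by
  set K := (H * G ^ 2 + L) * (R₀ / (1 - M.γ) ^ 2)
  have hK : 0 ≤ K := by positivity
  have h1 := Finset.sum_le_sum fun t (ht : t ∈ Finset.Icc 1 n) =>
    hrun.norm_gradient_J_theta_le hR₀ hG hL hr hpol hη₀ (Finset.mem_Icc.1 ht).1
      ((Finset.mem_Icc.1 ht).2.trans_lt hn) ω
  refine h1.trans ?_
  rw [Finset.sum_add_distrib, Finset.sum_add_distrib, ← Finset.mul_sum, ← Finset.mul_sum,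
    ← Finset.sum_div]
  have hmono : Monotone fun t : ℕ => (t : ℝ) ^ ((2 : ℝ) / 3) := fun i j hij =>
    Real.rpow_le_rpow (Nat.cast_nonneg i) (Nat.cast_le.2 hij) (by norm_num)
  have h2 := sum_Icc_mul_sub_le (f := fun t => M.J pol H (θ t ω)) hmono
    (fun t => Real.rpow_nonneg (Nat.cast_nonneg t) _) (fun t => abs_J_le hR₀ hr _) n
  have h3 := sum_Icc_rpow_sub_one_le (p := 1 / 3) (by norm_num) (by norm_num) n
  have h4 : K * η₀ * ∑ t ∈ Finset.Icc 1 n, (t : ℝ) ^ ((1 : ℝ) / 3 - 1) ≤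
      3 * K * η₀ * (n : ℝ) ^ ((1 : ℝ) / 3) := by
    refine (mul_le_mul_of_nonneg_left h3 (mul_nonneg hK hη₀.le)).trans (le_of_eq ?_)
    ring
  exact add_le_add (add_le_add (div_le_div_of_nonneg_right h2 hη₀.le) le_rfl) h4

/-! ### The mean squared error of the momentum vectors -/

lemma measurable_error (hrun : IsSharpRun M pol H T θ₀ α₀ η₀ μ ℱ θ v b τ τb)
    (hR₀ : 0 ≤ R₀) (hG : 0 ≤ G) (hL : 0 ≤ L) (hr : M.BoundedReward R₀) (hpol : pol.Regular G L)
    {t : ℕ} (htT : t < T) : Measurable[ℱ t] fun ω => v t ω - gradient (M.J pol H) (θ t ω) :=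
  (hrun.measurable_theta_v hpol t htT).2.sub
    ((continuous_gradient_J hR₀ hG hL hr hpol).measurable.comp
      (hrun.measurable_theta_v hpol t htT).1)

lemma exists_norm_error_le (hrun : IsSharpRun M pol H T θ₀ α₀ η₀ μ ℱ θ v b τ τb)
    (hR₀ : 0 ≤ R₀) (hG : 0 ≤ G) (hL : 0 ≤ L) (hr : M.BoundedReward R₀) (hpol : pol.Regular G L)
    (hα₀ : 0 ≤ α₀) (hα₀' : α₀ ≤ 1) (hη₀ : 0 ≤ η₀) {t : ℕ} (htT : t < T) :
    ∃ B, ∀ ω, ‖v t ω - gradient (M.J pol H) (θ t ω)‖ ≤ B := by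
  obtain ⟨B, hB⟩ := hrun.exists_norm_v_le hR₀ hG hL hr hpol hα₀ hα₀' hη₀ t htT
  exact ⟨_, fun ω => norm_sub_le_of_le (hB ω) (norm_gradient_J_le hR₀ hG hr hpol _)⟩

variable [IsProbabilityMeasure μ]

/-- The error is `(1-α) e_{t-1} - m + Z`, with `Z` the sampled increment and `m` its conditional
mean; the second moment inequality applies. -/
lemma integral_norm_sq_error_le (hrun : IsSharpRun M pol H T θ₀ α₀ η₀ μ ℱ θ v b τ τb)
    (hR₀ : 0 ≤ R₀) (hG : 0 ≤ G) (hL : 0 ≤ L) (hr : M.BoundedReward R₀) (hpol : pol.Regular G L)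
    (hα₀ : 0 ≤ α₀) (hα₀' : α₀ ≤ 1) (hη₀ : 0 ≤ η₀) {t : ℕ} (ht : 1 ≤ t) (htT : t < T) :
    ∫ ω, ‖v t ω - gradient (M.J pol H) (θ t ω)‖ ^ 2 ∂μ ≤
      (1 - sharpAlpha α₀ t) ^ 2 *
        ∫ ω, ‖v (t - 1) ω - gradient (M.J pol H) (θ (t - 1) ω)‖ ^ 2 ∂μ +
      ((1 - sharpAlpha α₀ t) * ((H * G ^ 2 + L) * (R₀ / (1 - M.γ) ^ 2) * sharpEta η₀ (t - 1)) +
        sharpAlpha α₀ t * (G * (R₀ / (1 - M.γ) ^ 2))) ^ 2 := by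
  have hZb := fun ω => hrun.norm_sharpIncrement_sample_le hR₀ hG hL hr hpol hα₀ hα₀' hη₀ ht htT ω
  have hα0 : 0 ≤ sharpAlpha α₀ t := sharpAlpha_nonneg hα₀ t
  have hα1 : sharpAlpha α₀ t ≤ 1 := sharpAlpha_le_one hα₀' ht
  have hveq := fun ω => hrun.v_eq ht htT ω
  generalize sharpAlpha α₀ t = α at *
  have ht1 : t - 1 < T := by omega
  have hgrad : Measurable (gradient (M.J pol H)) :=
    (continuous_gradient_J hR₀ hG hL hr hpol).measurable
  have hθ' : Measurable[ℱ (t - 1)] (θ (t - 1)) := (hrun.measurable_theta_v hpol _ ht1).1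
  have hθ : Measurable[ℱ (t - 1)] (θ t) := by
    have h := hrun.measurable_theta_succ hpol ht1
    rwa [Nat.sub_add_cancel ht] at h
  have he : Measurable[ℱ (t - 1)] fun ω => v (t - 1) ω - gradient (M.J pol H) (θ (t - 1) ω) :=
    hrun.measurable_error hR₀ hG hL hr hpol ht1
  have hmean : Measurable[ℱ (t - 1)] fun ω =>
      (1 - α) • (gradient (M.J pol H) (θ t ω) - gradient (M.J pol H) (θ (t - 1) ω)) +
        α • gradient (M.J pol H) (θ t ω) := by
    have hF : Measurable fun x : EuclideanSpace ℝ (Fin d) × EuclideanSpace ℝ (Fin d) =>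
        (1 - α) • (gradient (M.J pol H) x.1 - gradient (M.J pol H) x.2) +
          α • gradient (M.J pol H) x.1 := by fun_prop
    have h := hF.comp (hθ.prodMk hθ')
    exact h
  have hle : ℱ (t - 1) ≤ mΩ := ℱ.le _
  have hZm : Measurable fun ω =>
      M.sharpIncrement pol α (θ t ω, θ (t - 1) ω) (b t ω, τ t ω, τb t ω) := by
    have hx := ((hθ.mono hle le_rfl).prodMk (hθ'.mono hle le_rfl)).prodMk
      ((hrun.measurable_sample ht htT).mono (ℱ.le _) le_rfl)
    have h := (M.measurable_sharpIncrement (H := H) hpol α).comp hx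
    exact h
  obtain ⟨B, hB⟩ := hrun.exists_norm_error_le hR₀ hG hL hr hpol hα₀ hα₀' hη₀ ht1
  have hg := fun θ => norm_gradient_J_le (H := H) hR₀ hG hr hpol θ
  have hmb := fun ω => norm_add_le_of_le
    ((norm_smul_le (1 - α) _).trans (mul_le_mul_of_nonneg_left
      (norm_sub_le_of_le (hg (θ t ω)) (hg (θ (t - 1) ω))) (norm_nonneg (1 - α))))
    ((norm_smul_le α _).trans (mul_le_mul_of_nonneg_left (hg (θ t ω)) (norm_nonneg α)))
  have hInt : ∀ p, Integrable (M.sharpIncrement pol α p) (M.sampleKernel pol H p) := fun p =>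
    Integrable.of_bound (Measurable.of_uncurry_left
      (f := M.sharpIncrement pol α) (M.measurable_sharpIncrement hpol α)).aestronglyMeasurable _
      (Filter.Eventually.of_forall fun x => norm_sharpIncrement_le hR₀ hG hL hr hpol hα0 hα1 p x)
  -- `(1-α) e_{t-1} - m` is known at time `t - 1`, because `θ_t` already is.
  have hU := (measurable_fst.const_smul (1 - α)).sub measurable_snd |>.comp (he.prodMk hmean)
  have key := integral_norm_sq_add_le_of_integral_inner_eq (μ := μ) (1 - α)
    (he.mono hle le_rfl) (hmean.mono hle le_rfl) hZm hB hmb hZb (fun hUZ => by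
      refine (hrun.integral_inner_sharpIncrement ht htT hpol hθ hθ' hU hUZ hInt).trans ?_
      simp only [integral_sharpIncrement hR₀ hG hL hr hpol]
      rfl)
  refine le_trans (le_of_eq ?_) key
  congr 1 with ω
  congr 2
  rw [hveq ω]
  module

lemma integral_norm_sq_error_le_sharpC_div (hrun : IsSharpRun M pol H T θ₀ α₀ η₀ μ ℱ θ v b τ τb)
    (hR₀ : 0 ≤ R₀) (hG : 0 ≤ G) (hL : 0 ≤ L) (hr : M.BoundedReward R₀) (hpol : pol.Regular G L)
    (hα₀ : 2 / 3 < α₀) (hα₀' : α₀ ≤ 1) (hη₀ : 0 ≤ η₀) {t : ℕ} (ht : 1 ≤ t) (htT : t < T) :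
    ∫ ω, ‖v t ω - gradient (M.J pol H) (θ t ω)‖ ^ 2 ∂μ ≤
      sharpC α₀ η₀ (M.sigmaG R₀ G) (M.sigmaB H R₀ G L) / (t : ℝ) ^ ((2 : ℝ) / 3) := by
  refine le_sharpC_div_of_recursion (T := T) hα₀ hα₀'
    (a := fun t => ∫ ω, ‖v t ω - gradient (M.J pol H) (θ t ω)‖ ^ 2 ∂μ)
    (fun t => integral_nonneg fun _ => sq_nonneg _) ?_ (fun t ht htT => ?_) t ht htT
  · rw [sigmaG_eq hR₀ hG]
    have hb : ∀ ω, ‖v 0 ω - gradient (M.J pol H) (θ 0 ω)‖ ^ 2 ≤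
        4 * (G * (R₀ / (1 - M.γ) ^ 2)) ^ 2 := fun ω => by
      have h := norm_sub_le_of_le (norm_gradEst_le hR₀ hG hr hpol (τ 0 ω) (θ 0 ω))
        (norm_gradient_J_le (H := H) hR₀ hG hr hpol (θ 0 ω))
      rw [hrun.v_zero ω]
      refine (pow_le_pow_left₀ (norm_nonneg _) h 2).trans (le_of_eq ?_)
      ring
    calc _ ≤ ∫ ω, 4 * (G * (R₀ / (1 - M.γ) ^ 2)) ^ 2 ∂μ :=
          integral_mono_of_nonneg (Filter.Eventually.of_forall fun _ => sq_nonneg _)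
            (integrable_const _) (Filter.Eventually.of_forall hb)
      _ = _ := by simp
  · refine (hrun.integral_norm_sq_error_le hR₀ hG hL hr hpol (by linarith) hα₀' hη₀ ht htT).trans ?_
    rw [sigmaG_eq hR₀ hG]
    refine add_le_add_right ?_ _
    have hK := sq_le_two_mul_sigmaB_sq (M := M) (H := H) (R₀ := R₀) (G := G) (L := L)
    set K := (H * G ^ 2 + L) * (R₀ / (1 - M.γ) ^ 2)
    set x := (1 - sharpAlpha α₀ t) * sharpEta η₀ (t - 1)
    set y := sharpAlpha α₀ t * (G * (R₀ / (1 - M.γ) ^ 2))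
    have e1 : (1 - sharpAlpha α₀ t) * (K * sharpEta η₀ (t - 1)) = K * x := by ring
    have e2 : (1 - sharpAlpha α₀ t) * (M.sigmaB H R₀ G L * sharpEta η₀ (t - 1)) =
      M.sigmaB H R₀ G L * x := by ring
    rw [e1, e2]
    -- `(Kx + y)² ≤ 2K²x² + 2y²` together with `K² ≤ 2σ_B²` yields the coefficients 4 and 2.
    nlinarith [mul_le_mul_of_nonneg_right hK (sq_nonneg x), sq_nonneg (K * x - y)]

lemma integrable_norm_error (hrun : IsSharpRun M pol H T θ₀ α₀ η₀ μ ℱ θ v b τ τb)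
    (hR₀ : 0 ≤ R₀) (hG : 0 ≤ G) (hL : 0 ≤ L) (hr : M.BoundedReward R₀) (hpol : pol.Regular G L)
    (hα₀ : 0 ≤ α₀) (hα₀' : α₀ ≤ 1) (hη₀ : 0 ≤ η₀) {t : ℕ} (htT : t < T) :
    Integrable (fun ω => ‖v t ω - gradient (M.J pol H) (θ t ω)‖) μ ∧
      Integrable (fun ω => ‖v t ω - gradient (M.J pol H) (θ t ω)‖ ^ 2) μ := by
  obtain ⟨B, hB⟩ := hrun.exists_norm_error_le hR₀ hG hL hr hpol hα₀ hα₀' hη₀ htT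
  have hm := ((hrun.measurable_error hR₀ hG hL hr hpol htT).mono (ℱ.le _) le_rfl).norm
  refine ⟨Integrable.of_bound hm.aestronglyMeasurable B (Filter.Eventually.of_forall fun ω => ?_),
    Integrable.of_bound (hm.pow_const 2).aestronglyMeasurable (B ^ 2)
      (Filter.Eventually.of_forall fun ω => ?_)⟩
  · rw [norm_norm]; exact hB ω
  · rw [norm_pow, norm_norm]; exact pow_le_pow_left₀ (norm_nonneg _) (hB ω) 2

lemma integral_norm_error_le (hrun : IsSharpRun M pol H T θ₀ α₀ η₀ μ ℱ θ v b τ τb)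
    (hR₀ : 0 < R₀) (hG : 0 < G) (hL : 0 ≤ L) (hr : M.BoundedReward R₀) (hpol : pol.Regular G L)
    (hα₀ : 2 / 3 < α₀) (hα₀' : α₀ ≤ 1) (hη₀ : 0 ≤ η₀) {t : ℕ} (ht : 1 ≤ t) (htT : t < T) :
    ∫ ω, ‖v t ω - gradient (M.J pol H) (θ t ω)‖ ∂μ ≤
      Real.sqrt (sharpC α₀ η₀ (M.sigmaG R₀ G) (M.sigmaB H R₀ G L)) *
        (t : ℝ) ^ ((2 : ℝ) / 3 - 1) := by
  have hsq := hrun.integral_norm_sq_error_le_sharpC_div hR₀.le hG.le hL hr hpol hα₀ hα₀' hη₀ ht htT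
  obtain ⟨hi1, hi2⟩ := hrun.integrable_norm_error hR₀.le hG.le hL hr hpol (by linarith) hα₀' hη₀ htT
  have ht0 : (0 : ℝ) < t := by exact_mod_cast ht
  -- Nonnegativity of the variance is used as `(E X)² ≤ E X²`.
  have hvar := variance_nonneg (fun ω => ‖v t ω - gradient (M.J pol H) (θ t ω)‖) μ
  rw [variance_eq_sub ((memLp_two_iff_integrable_sq hi1.aestronglyMeasurable).2 hi2)] at hvar
  simp only [Pi.pow_apply] at hvar
  refine (Real.le_sqrt_of_sq_le ((sub_nonneg.1 hvar).trans hsq)).trans (le_of_eq ?_)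
  rw [Real.sqrt_div' _ (Real.rpow_nonneg ht0.le _), Real.sqrt_eq_rpow (_ ^ _), ← Real.rpow_mul ht0.le,
    div_eq_mul_inv, ← Real.rpow_neg ht0.le]
  norm_num

end IsSharpRun

end

/-! ### The sum over all iterations -/

noncomputable section

namespace IsSharpRun

open MDP

variable {S A Ω : Type*} [MeasurableSpace S] [MeasurableSpace A] [mΩ : MeasurableSpace Ω]
  {d : ℕ} {ν : Measure A} [SFinite ν] {M : MDP S A} {pol : ParamPolicy S A d ν} {H T : ℕ}
  {θ₀ : EuclideanSpace ℝ (Fin d)} {α₀ η₀ : ℝ} {μ : Measure Ω} [IsProbabilityMeasure μ]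
  {ℱ : Filtration ℕ mΩ} {θ v : ℕ → Ω → EuclideanSpace ℝ (Fin d)} {b : ℕ → Ω → ℝ}
  {τ τb : ℕ → Ω → Traj S A H} {R₀ G L : ℝ}

lemma integrable_sum_norm_gradient_J (hrun : IsSharpRun M pol H T θ₀ α₀ η₀ μ ℱ θ v b τ τb)
    (hR₀ : 0 ≤ R₀) (hG : 0 ≤ G) (hL : 0 ≤ L) (hr : M.BoundedReward R₀) (hpol : pol.Regular G L) :
    Integrable (fun ω => ∑ t ∈ Finset.Icc 1 T, ‖gradient (M.J pol H) (θ t ω)‖) μ := by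
  refine integrable_finsetSum _ fun t ht => ?_
  obtain ⟨ht1, htT⟩ := Finset.mem_Icc.1 ht
  have hθ := hrun.measurable_theta_succ hpol (t := t - 1) (by omega)
  rw [Nat.sub_add_cancel ht1] at hθ
  have hm := ((continuous_gradient_J (H := H) hR₀ hG hL hr hpol).measurable.comp
    (hθ.mono (ℱ.le _) le_rfl)).norm
  exact Integrable.of_bound hm.aestronglyMeasurable (G * (R₀ / (1 - M.γ) ^ 2))
    (Filter.Eventually.of_forall fun ω => by
      rw [norm_norm]; exact norm_gradient_J_le hR₀ hG hr hpol _)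

lemma integral_sum_norm_gradient_J_le (hrun : IsSharpRun M pol H T θ₀ α₀ η₀ μ ℱ θ v b τ τb)
    (hT : 1 ≤ T) (hR₀ : 0 < R₀) (hG : 0 < G) (hL : 0 ≤ L) (hr : M.BoundedReward R₀)
    (hpol : pol.Regular G L) (hα₀ : 2 / 3 < α₀) (hα₀' : α₀ ≤ 1) (hη₀ : 0 < η₀) :
    ∫ ω, ∑ t ∈ Finset.Icc 1 T, ‖gradient (M.J pol H) (θ t ω)‖ ∂μ ≤
      (8 * Real.sqrt (sharpC α₀ η₀ (M.sigmaG R₀ G) (M.sigmaB H R₀ G L)) +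
        9 * (R₀ / (1 - M.γ)) / η₀) * (T : ℝ) ^ ((2 : ℝ) / 3) +
      6 * M.sigmaB H R₀ G L * η₀ * (T : ℝ) ^ ((1 : ℝ) / 3) := by
  -- The sum includes `θ_T`, but a run constrains `v_t` only for `t < T`. The ascent bound therefore
  -- covers `t ≤ n = T - 1`, and the last gradient is bounded by `σ_g`.
  obtain ⟨n, rfl⟩ : ∃ n, T = n + 1 := ⟨T - 1, by omega⟩
  have hσ := sigmaG_eq (M := M) hR₀.le hG.le
  have hC := le_sharpC (η₀ := η₀) (σg := M.sigmaG R₀ G) (σB := M.sigmaB H R₀ G L) hα₀ hα₀'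
  have herr := fun t (ht : t ∈ Finset.Icc 1 n) => hrun.integral_norm_error_le hR₀ hG hL hr hpol
    hα₀ hα₀' hη₀.le (Finset.mem_Icc.1 ht).1 (Nat.lt_succ_of_le (Finset.mem_Icc.1 ht).2)
  set C := sharpC α₀ η₀ (M.sigmaG R₀ G) (M.sigmaB H R₀ G L)
  set K := (H * G ^ 2 + L) * (R₀ / (1 - M.γ) ^ 2)
  have hK : K ≤ 2 * M.sigmaB H R₀ G L := le_two_mul_sigmaB
  have hγ : 0 < 1 - M.γ := sub_pos.2 M.γ_lt_one
  have hcJ : 0 ≤ R₀ / (1 - M.γ) / η₀ := by positivity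
  have hσC : M.sigmaG R₀ G ≤ Real.sqrt C := by
    refine Real.le_sqrt_of_sq_le (le_trans ?_ hC)
    nlinarith [sq_nonneg (M.sigmaB H R₀ G L * η₀), sq_nonneg (α₀ * M.sigmaG R₀ G)]
  have hpath : ∀ ω, ∑ t ∈ Finset.Icc 1 (n + 1), ‖gradient (M.J pol H) (θ t ω)‖ ≤
      2 * ∑ t ∈ Finset.Icc 1 n, ‖v t ω - gradient (M.J pol H) (θ t ω)‖ +
      (2 * (R₀ / (1 - M.γ)) * (n : ℝ) ^ ((2 : ℝ) / 3) / η₀ +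
        3 * K * η₀ * (n : ℝ) ^ ((1 : ℝ) / 3) + M.sigmaG R₀ G) := fun ω => by
    rw [Finset.sum_Icc_succ_top (by omega), hσ]
    linarith [hrun.sum_norm_gradient_J_le hR₀.le hG.le hL hr hpol hη₀ n.lt_succ_self ω,
      norm_gradient_J_le (H := H) hR₀.le hG.le hr hpol (θ (n + 1) ω)]
  have hInt : ∀ t ∈ Finset.Icc 1 n,
      Integrable (fun ω => ‖v t ω - gradient (M.J pol H) (θ t ω)‖) μ := fun t ht =>
    (hrun.integrable_norm_error hR₀.le hG.le hL hr hpol (by linarith) hα₀' hη₀.le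
      (Nat.lt_succ_of_le (Finset.mem_Icc.1 ht).2)).1
  have hsum := (integrable_finsetSum _ hInt).const_mul 2
  have hsumerr : ∑ t ∈ Finset.Icc 1 n, ∫ ω, ‖v t ω - gradient (M.J pol H) (θ t ω)‖ ∂μ ≤
      Real.sqrt C * (3 / 2 * (n : ℝ) ^ ((2 : ℝ) / 3)) := by
    refine (Finset.sum_le_sum herr).trans ?_
    rw [← Finset.mul_sum]
    refine mul_le_mul_of_nonneg_left ?_ (Real.sqrt_nonneg _)
    refine (sum_Icc_rpow_sub_one_le (by norm_num) (by norm_num) n).trans (le_of_eq ?_)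
    ring
  have hbound : ∫ ω, ∑ t ∈ Finset.Icc 1 (n + 1), ‖gradient (M.J pol H) (θ t ω)‖ ∂μ ≤
      2 * (Real.sqrt C * (3 / 2 * (n : ℝ) ^ ((2 : ℝ) / 3))) +
      (2 * (R₀ / (1 - M.γ)) * (n : ℝ) ^ ((2 : ℝ) / 3) / η₀ +
        3 * K * η₀ * (n : ℝ) ^ ((1 : ℝ) / 3) + M.sigmaG R₀ G) := by
    refine (integral_mono (hrun.integrable_sum_norm_gradient_J hR₀.le hG.le hL hr hpol)
      (hsum.add (integrable_const _)) hpath).trans ?_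
    rw [integral_add' hsum (integrable_const _), integral_const_mul, integral_finsetSum _ hInt,
      integral_const, probReal_univ, one_smul]
    exact add_le_add_left (mul_le_mul_of_nonneg_left hsumerr zero_le_two) _
  refine hbound.trans ?_
  have hx : (n : ℝ) ^ ((2 : ℝ) / 3) ≤ ((n + 1 : ℕ) : ℝ) ^ ((2 : ℝ) / 3) :=
    Real.rpow_le_rpow n.cast_nonneg (by push_cast; linarith) (by norm_num)
  have hy : (n : ℝ) ^ ((1 : ℝ) / 3) ≤ ((n + 1 : ℕ) : ℝ) ^ ((1 : ℝ) / 3) :=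
    Real.rpow_le_rpow n.cast_nonneg (by push_cast; linarith) (by norm_num)
  have hx1 : 1 ≤ ((n + 1 : ℕ) : ℝ) ^ ((2 : ℝ) / 3) :=
    Real.one_le_rpow (by push_cast; linarith [n.cast_nonneg (α := ℝ)]) (by norm_num)
  have hy0 : 0 ≤ (n : ℝ) ^ ((1 : ℝ) / 3) := Real.rpow_nonneg n.cast_nonneg _
  set x := (n : ℝ) ^ ((2 : ℝ) / 3)
  set x' := ((n + 1 : ℕ) : ℝ) ^ ((2 : ℝ) / 3)
  set y := (n : ℝ) ^ ((1 : ℝ) / 3)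
  set y' := ((n + 1 : ℕ) : ℝ) ^ ((1 : ℝ) / 3)
  have hsC : 0 ≤ Real.sqrt C := Real.sqrt_nonneg _
  have t1 : Real.sqrt C * x ≤ Real.sqrt C * x' := mul_le_mul_of_nonneg_left hx hsC
  have t2 : R₀ / (1 - M.γ) / η₀ * x ≤ R₀ / (1 - M.γ) / η₀ * x' := mul_le_mul_of_nonneg_left hx hcJ
  have t3 : K * (η₀ * y) ≤ 2 * M.sigmaB H R₀ G L * (η₀ * y') :=
    mul_le_mul hK (mul_le_mul_of_nonneg_left hy hη₀.le) (mul_nonneg hη₀.le hy0)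
      (mul_nonneg zero_le_two (Real.sqrt_nonneg _))
  have t4 : M.sigmaG R₀ G ≤ Real.sqrt C * x' := hσC.trans (le_mul_of_one_le_right hsC hx1)
  have t5 : 0 ≤ R₀ / (1 - M.γ) / η₀ * x' := mul_nonneg hcJ (by linarith)
  have t6 : 0 ≤ Real.sqrt C * x' := mul_nonneg hsC (by linarith)
  have e1 : 2 * (R₀ / (1 - M.γ)) * x / η₀ = 2 * (R₀ / (1 - M.γ) / η₀ * x) := by ring
  have e2 : 9 * (R₀ / (1 - M.γ)) / η₀ = 9 * (R₀ / (1 - M.γ) / η₀) := by ring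
  rw [e1, e2]
  -- The errors use `3√C` and the last iterate one more `√C`, out of 8; the increments of `J` use 2
  -- out of 9; `3K ≤ 6σ_B` is used in full.
  linarith

end IsSharpRun

end


theorem theorem1 {S A Ω : Type*} [MeasurableSpace S] [MeasurableSpace A] [mΩ : MeasurableSpace Ω]
    {d : ℕ} {ν : Measure A} [SigmaFinite ν] (M : MDP S A) (pol : ParamPolicy S A d ν) (H : ℕ)
    (R₀ G L : ℝ) (hR₀ : 0 < R₀) (hG : 0 < G) (hL : 0 < L)
    (hreward : M.BoundedReward R₀) (hpol : pol.Regular G L)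
    (α₀ η₀ : ℝ) (hα₀ : 2 / 3 < α₀) (hα₀' : α₀ ≤ 1) (hη₀ : 0 < η₀)
    (T : ℕ) (hT : 1 ≤ T) (θ₀ : EuclideanSpace ℝ (Fin d))
    (μ : Measure Ω) [IsProbabilityMeasure μ] (ℱ : Filtration ℕ mΩ)
    (θ v : ℕ → Ω → EuclideanSpace ℝ (Fin d)) (b : ℕ → Ω → ℝ) (τ τb : ℕ → Ω → Traj S A H)
    (hrun : IsSharpRun M pol H T θ₀ α₀ η₀ μ ℱ θ v b τ τb) :
    Differentiable ℝ (M.J pol H) ∧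
    Integrable (fun ω => (1 / (T : ℝ)) *
      ∑ t ∈ Finset.Icc 1 T, ‖gradient (M.J pol H) (θ t ω)‖) μ ∧
    ∫ ω, (1 / (T : ℝ)) * ∑ t ∈ Finset.Icc 1 T, ‖gradient (M.J pol H) (θ t ω)‖ ∂μ ≤
      (8 * Real.sqrt (sharpC α₀ η₀ (M.sigmaG R₀ G) (M.sigmaB H R₀ G L))
          + 9 * (R₀ / (1 - M.γ)) / η₀) / (T : ℝ) ^ ((1 : ℝ) / 3)
        + 6 * M.sigmaB H R₀ G L * η₀ / (T : ℝ) ^ ((2 : ℝ) / 3) := by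
  refine ⟨fun θ => (MDP.hasGradientAt_J hR₀.le hG.le hreward hpol θ).differentiableAt,
    (hrun.integrable_sum_norm_gradient_J hR₀.le hG.le hL.le hreward hpol).const_mul _, ?_⟩
  rw [integral_const_mul]
  have h := hrun.integral_sum_norm_gradient_J_le hT hR₀ hG hL.le hreward hpol hα₀ hα₀' hη₀
  have hT0 : (0 : ℝ) < T := by exact_mod_cast hT
  have h1 : (T : ℝ) ^ ((2 : ℝ) / 3) / T = ((T : ℝ) ^ ((1 : ℝ) / 3))⁻¹ := by
    rw [← Real.rpow_sub_one hT0.ne', ← Real.rpow_neg hT0.le]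
    norm_num
  have h2 : (T : ℝ) ^ ((1 : ℝ) / 3) / T = ((T : ℝ) ^ ((2 : ℝ) / 3))⁻¹ := by
    rw [← Real.rpow_sub_one hT0.ne', ← Real.rpow_neg hT0.le]
    norm_num
  refine (mul_le_mul_of_nonneg_left h (by positivity)).trans (le_of_eq ?_)
  rw [div_eq_mul_inv _ ((T : ℝ) ^ ((1 : ℝ) / 3)), div_eq_mul_inv _ ((T : ℝ) ^ ((2 : ℝ) / 3)),
    ← h1, ← h2]
  ring
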